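/- **Probabilistic zero forcing.** Let $G$ be a finite graph with a set of blue vertices; the other vertices are white. In each round, if $Z$ is the current set of blue vertices, every $u\in Z$ attempts, independently, to force each of its white neighbours, and each attempt succeeds with probability $|N[u]\cap Z|/\deg(u)$; a white vertex becomes blue if at least one attempt on it succeeds. Let $pt(G)$ be the minimum, over all vertices $v$ of $G$, of the number of rounds until all vertices are blue in a run started with $v$ as the only blue vertex, where the runs for different $v$ are independent. Let $G_{n\times n}$ be the $n\times n$ grid (the Cartesian product of two paths on $n$ vertices). **The $d$-window chain.** For $d\ge 2$ let $P_d$ be the following Markov chain on $\{0,1\}^d$ ($1$ is blue, $0$ is white). From $C=(c_1,\dots,c_d)\ne(0,\dots,0)$, put $c_0=c_{d+1}=0$ and draw independent bits $u_0,\dots,u_d$ with $\mathbb P(u_k=1)=1-(1/4)^{c_k+c_{k+1}}$; the next state is whichever of $(u_0,\dots,u_{d-1})$ and $(u_1,\dots,u_d)$ has more ones, and one of the two chosen uniformly at random if they have equally many. From $(0,\dots,0)$ the next state has exactly three ones, consecutive and centred: for odd $d$ it is $0^{(d-3)/2}\,1^3\,0^{(d-3)/2}$; for even $d\ge4$ it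 is $0^{(d-4)/2}\,1^3\,0^{(d-2)/2}$ or $0^{(d-2)/2}\,1^3\,0^{(d-4)/2}$, with probability $1/2$ each; for $d=2$ it is $(1,1)$. **Statement.** Fix $d\ge 2$. The chain $P_d$ has a stationary distribution which is its limiting distribution from every initial state. Let $\mu_d$ be the probability of the all-white state $(0,\dots,0)$ in it. Then $\mu_d<1/2$, and there is a sequence $\varepsilon_n\to0$ such that $$\lim_{n\to\infty}\mathbb P\left(pt(G_{n\times n})\le(1+\varepsilon_n)\,\frac{1-\mu_d}{1-2\mu_d}\,n\right)=1 .$$ -/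

import Mathlib

open Filter Topology MeasureTheory

noncomputable section

namespace PZF

/-! ## Probabilistic zero forcing -/

/-- The probability `|N[u] ∩ Z| / deg u` with which, when `Z` is the set of blue vertices,
the blue vertex `u` forces a given white neighbour during one round. -/
def forceProb {V : Type*} (G : SimpleGraph V) (Z : Set V) (u : V) : ℝ :=
  ((insert u (G.neighborSet u) ∩ Z).ncard : ℝ) / ((G.neighborSet u).ncard : ℝ)

/-- Sample space of one run: a number in `[0, 1]` for every round `t` and every ordered pair
`(u, w)`, deciding the attempt of `u` to force `w` in round `t + 1`. -/
abbrev RunSpace (V : Type*) : Type _ := ℕ × V × V → unitInterval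

/-- In a run the numbers are independent and uniformly distributed on `[0, 1]`. -/
def runMeasure (V : Type*) : Measure (RunSpace V) :=
  Measure.infinitePi fun _ : ℕ × V × V => (volume : Measure unitInterval)

/-- The set of blue vertices after `t` rounds, when `Z` is the initial set of blue vertices:
in each round every blue vertex `u` attempts to force each of its white neighbours `w`, and
succeeds when the uniform number of this attempt is at most `forceProb`. -/
def blueSet {V : Type*} (G : SimpleGraph V) (Z : Set V) (ω : RunSpace V) : ℕ → Set V
  | 0 => Z
  | t + 1 => blueSet G Z ω t ∪
      {w | ∃ u ∈ blueSet G Z ω t, G.Adj u w ∧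
        (ω (t, u, w) : ℝ) ≤ forceProb G (blueSet G Z ω t) u}

/-- The propagation time of one run with initial blue set `Z`: the least number of rounds after
which all vertices are blue (`⊤` if this never happens). -/
def runPropTime {V : Type*} (G : SimpleGraph V) (Z : Set V) (ω : RunSpace V) : ℕ∞ :=
  ⨅ (t : ℕ) (_ : blueSet G Z ω t = Set.univ), (t : ℕ∞)

/-- The sample space of the experiment that performs one run for each vertex. -/
abbrev ExpSpace (V : Type*) : Type _ := V → RunSpace V

/-- The runs for different vertices are independent. -/
def expMeasure (V : Type*) [Fintype V] : Measure (ExpSpace V) :=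
  Measure.pi fun _ : V => runMeasure V

/-- The propagation time of the graph: the minimum over the vertices `v` of the propagation time
of the run for `v`, which starts with `v` as its only blue vertex. -/
def propTime {V : Type*} (G : SimpleGraph V) (ω : ExpSpace V) : ℕ∞ :=
  ⨅ v : V, runPropTime G {v} (ω v)

/-- The `m` by `n` grid: the Cartesian product of the paths on `m` and on `n` vertices. -/
def grid (m n : ℕ) : SimpleGraph (Fin m × Fin n) :=
  (SimpleGraph.pathGraph m).boxProd (SimpleGraph.pathGraph n)

/-! ## The Markov chain of configurations of a window -/

/-- A configuration of a `d`-window; `true` is blue and `false` is white. -/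
abbrev Config (d : ℕ) : Type := Fin d → Bool

/-- The all white configuration. -/
def allWhite (d : ℕ) : Config d := fun _ => false

/-- The all blue configuration. -/
def allBlue (d : ℕ) : Config d := fun _ => true

/-- The number of blue vertices of a configuration. -/
def blueCount {d : ℕ} (C : Config d) : ℕ := (Finset.univ.filter fun i => C i = true).card

/-- Let `v 0, …, v (d - 1)` be the vertices of a window with configuration `C`, from top left to
bottom right. Its neighbours on the next diagonal are `u 0, …, u d`, where `u k` is adjacent to
`v (k - 1)` (if `1 ≤ k`) and to `v k` (if `k < d`). This is the number of blue vertices of the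
window that are adjacent to `u k`. -/
def blueNbrs {d : ℕ} (C : Config d) (k : Fin (d + 1)) : ℕ :=
  ((Fin.cons false C : Config (d + 1)) k).toNat + ((Fin.snoc C false : Config (d + 1)) k).toNat

/-- The probability that `u k` turns blue: `15/16`, `3/4` or `0` if it is adjacent to two, one or
no blue vertices of the window. -/
def turnBlueProb {d : ℕ} (C : Config d) (k : Fin (d + 1)) : ℝ := 1 - (1 / 4) ^ blueNbrs C k

/-- The probability that the next diagonal `u 0, …, u d` gets the colours `U`. -/
def diagProb {d : ℕ} (C : Config d) (U : Config (d + 1)) : ℝ :=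
  ∏ k, if U k = true then turnBlueProb C k else 1 - turnBlueProb C k

/-- The next window is whichever of `X = (u 0, …, u (d - 1))` and `Y = (u 1, …, u d)` has more
blue vertices, and one of the two chosen uniformly at random if they have equally many. This is
the probability that its configuration is `C'` when the next diagonal has the colours `U`. -/
def selectProb {d : ℕ} (U : Config (d + 1)) (C' : Config d) : ℝ :=
  let X : Config d := Fin.init U
  let Y : Config d := Fin.tail U
  if blueCount Y < blueCount X then (if C' = X then 1 else 0)
  else if blueCount X < blueCount Y then (if C' = Y then 1 else 0)
  else (1 / 2) * (if C' = X then 1 else 0) + (1 / 2) * (if C' = Y then 1 else 0)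

/-- The configuration whose blue vertices are those at the positions `a`, `a + 1`, `a + 2`
(counted from `0`). -/
def threeBlue (d a : ℕ) : Config d := fun i => decide (a ≤ (i : ℕ) ∧ (i : ℕ) < a + 3)

/-- The transition probabilities from the all white configuration: to three consecutive centred
blue vertices (with a uniform choice between the two most central positions if `d` is even), and
to the all blue configuration if `d = 2`. -/
def resetProb (d : ℕ) (C' : Config d) : ℝ :=
  if d = 2 then (if C' = allBlue d then 1 else 0)
  else if Odd d then (if C' = threeBlue d ((d - 3) / 2) then 1 else 0)
  else (1 / 2) * (if C' = threeBlue d ((d - 4) / 2) then 1 else 0)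
    + (1 / 2) * (if C' = threeBlue d ((d - 2) / 2) then 1 else 0)

/-- The transition matrix of the `d`-window Markov chain (meant for `2 ≤ d`). -/
def windowChain (d : ℕ) : Matrix (Config d) (Config d) ℝ := fun C C' =>
  if C = allWhite d then resetProb d C' else ∑ U : Config (d + 1), diagProb C U * selectProb U C'

/-- `π` is a stationary probability distribution of the transition matrix `P`. -/
def IsStationary {S : Type*} [Fintype S] (P : Matrix S S ℝ) (π : S → ℝ) : Prop :=
  (∀ x, 0 ≤ π x) ∧ ∑ x, π x = 1 ∧ Matrix.vecMul π P = π

/-- `π` is the limiting distribution of the transition matrix `P`: from every initial state `x`,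
the law of the chain after `t` steps converges to `π`. -/
def IsLimiting {S : Type*} [Fintype S] [DecidableEq S] (P : Matrix S S ℝ) (π : S → ℝ) : Prop :=
  ∀ x y, Tendsto (fun t : ℕ => (P ^ t) x y) atTop (𝓝 (π y))

end PZF

end

/-!
Follow a window of `d` vertices that moves across the antidiagonals of the grid, such that every
blue vertex `u` of the window is the apex of a blue cone reaching back along the diagonal. As `u`
has degree four and `N[u]` contains `u` and two blue predecessors, each attempt of `u` on the next
antidiagonal succeeds with probability at least `3/4`; if only attempts that already succeed at
probability `3/4` are counted, the configuration of the window is the chain `P_d`. A step from a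
configuration that is not all white takes one round and gains one level; an all white window is
reset, in no time, one level further back. Hence the window advances by `γ = (1 - 2μ) / (1 - μ)`
levels per round, and `μ ≤ 1/16` makes `γ` positive.

The level, relative to motion at speed `γ`, and the transversal position, which has no drift by the
reflection symmetry of the chain, become martingales after adding solutions of the Poisson equation.
A quadratic Lyapunov function then shows that a run of `O(n)` rounds misses its target by more than
`M` with probability `O(n / M ^ 2)`, which tends to zero for `M` of order `n`. Boundedly many
diagonal runs lead from the centre of the grid to every point of a coarse lattice. From there the
remaining vertices are reached by the crude bound for graphs of degree at most four, and since a
corner has distance about `n` from the centre, the total number of rounds is at most `(1 + η) n /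
γ`.
-/

noncomputable section

namespace PZF

section Rounds

variable {V : Type*} {G : SimpleGraph V}

/-- The set of blue vertices after one round started from `Z`, when `η` holds the uniform numbers
that decide the attempts of this round. -/
def afterRound (G : SimpleGraph V) (Z : Set V) (η : V × V → unitInterval) : Set V :=
  Z ∪ {w | ∃ u ∈ Z, G.Adj u w ∧ (η (u, w) : ℝ) ≤ forceProb G Z u}

/-- The law of the uniform numbers of one round. -/
def roundMeasure (V : Type*) : Measure (V × V → unitInterval) :=
  Measure.infinitePi fun _ : V × V => (volume : Measure unitInterval)

instance : IsProbabilityMeasure (roundMeasure V) := by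
  unfold roundMeasure; infer_instance

instance : IsProbabilityMeasure (runMeasure V) := by
  unfold runMeasure; infer_instance

/-- The run whose first round is `p.1` and whose later rounds form the run `p.2`. -/
def consRound (p : (V × V → unitInterval) × RunSpace V) : RunSpace V
  | (0, e) => p.1 e
  | (t + 1, e) => p.2 (t, e)

lemma measurable_consRound : Measurable (consRound (V := V)) := by
  refine measurable_pi_iff.2 ?_
  rintro ⟨_ | t, e⟩
  · exact (measurable_pi_apply e).comp measurable_fst
  · exact (measurable_pi_apply (t, e)).comp measurable_snd

lemma preimage_consRound_pi (s : Set (ℕ × V × V)) (A : ℕ × V × V → Set unitInterval) :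
    consRound ⁻¹' s.pi A =
      (Set.pi {e | (0, e) ∈ s} fun e => A (0, e)) ×ˢ
        Set.pi {e | (e.1 + 1, e.2) ∈ s} fun e => A (e.1 + 1, e.2) := by
  ext ⟨η, ω⟩
  simp only [Set.mem_preimage, Set.mem_pi, Set.mem_prod, Set.mem_ofPred_eq]
  refine ⟨fun h => ⟨fun e he => h _ he, fun e he => h _ he⟩, ?_⟩
  rintro ⟨h, h'⟩ ⟨_ | t, e⟩ he
  · exact h e he
  · exact h' (t, e) he

lemma measurePreserving_consRound :
    MeasurePreserving consRound ((roundMeasure V).prod (runMeasure V)) (runMeasure V) := by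
  classical
  refine ⟨measurable_consRound, Measure.eq_infinitePi _ fun s A hA => ?_⟩
  have h_first : Function.Injective fun e : V × V => ((0, e) : ℕ × V × V) :=
    fun _ _ h => congrArg Prod.snd h
  have h_later : Function.Injective fun e : ℕ × V × V => (e.1 + 1, e.2) :=
    fun _ _ h => Prod.ext (Nat.succ_injective (congrArg Prod.fst h)) (congrArg Prod.snd h :)
  have h_split : s.filter (fun e => e ∉ Set.range fun e : V × V => ((0, e) : ℕ × V × V)) =
      s.filter (fun e => e ∈ Set.range fun e : ℕ × V × V => (e.1 + 1, e.2)) :=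
    Finset.filter_congr <| by rintro ⟨_ | t, e⟩ _ <;> simp
  rw [Measure.map_apply measurable_consRound
    (MeasurableSet.pi s.countable_toSet fun i _ => hA i), preimage_consRound_pi, Measure.prod_prod,
    ← Finset.prod_filter_mul_prod_filter_not s
      (fun e => e ∈ Set.range fun e : V × V => ((0, e) : ℕ × V × V)), h_split,
    ← Finset.prod_preimage' _ s h_first.injOn, ← Finset.prod_preimage' _ s h_later.injOn,
    ← Measure.infinitePi_pi _ fun e _ => hA _, ← Measure.infinitePi_pi _ fun e _ => hA _]
  simp only [Finset.coe_preimage]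
  rfl

lemma blueSet_consRound (Z : Set V) (η : V × V → unitInterval) (ω : RunSpace V) (t : ℕ) :
    blueSet G Z (consRound (η, ω)) (t + 1) = blueSet G (afterRound G Z η) ω t := by
  induction t with
  | zero => rfl
  | succ t ih => rw [blueSet, ih]; rfl

lemma subset_afterRound (Z : Set V) (η : V × V → unitInterval) : Z ⊆ afterRound G Z η :=
  Set.subset_union_left

lemma subset_blueSet (Z : Set V) (ω : RunSpace V) (t : ℕ) : Z ⊆ blueSet G Z ω t := by
  induction t with
  | zero => exact subset_rfl
  | succ t ih => exact ih.trans Set.subset_union_left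

/-- The probability that some vertex of `B` is still white after `t` rounds, when `Z` is the
initial set of blue vertices. -/
def failProb (G : SimpleGraph V) (Z B : Set V) (t : ℕ) : ℝ :=
  (runMeasure V).real {ω | ¬ B ⊆ blueSet G Z ω t}

lemma failProb_nonneg (Z B : Set V) (t : ℕ) : 0 ≤ failProb G Z B t := measureReal_nonneg

lemma failProb_le_one (Z B : Set V) (t : ℕ) : failProb G Z B t ≤ 1 := measureReal_le_one

lemma failProb_eq_zero {Z B : Set V} (h : B ⊆ Z) (t : ℕ) : failProb G Z B t = 0 := by
  simp [failProb, h.trans (subset_blueSet Z _ t)]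

lemma failProb_zero {Z B : Set V} (h : ¬ B ⊆ Z) : failProb G Z B 0 = 1 := by
  simp [failProb, blueSet, h]

lemma failProb_biUnion_le {ι : Type*} (I : Finset ι) (Z : Set V) (B : ι → Set V) (t : ℕ) :
    failProb G Z (⋃ i ∈ I, B i) t ≤ ∑ i ∈ I, failProb G Z (B i) t := by
  refine le_trans (measureReal_mono (fun ω hω => ?_) (measure_ne_top _ _))
    (measureReal_biUnion_finset_le I _)
  by_contra hc
  simp only [Set.mem_iUnion, not_exists, Set.mem_ofPred_eq, not_not] at hc
  exact hω (Set.iUnion₂_subset hc)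

variable [Finite V]

lemma forceProb_mono {Z Z' : Set V} (h : Z ⊆ Z') (u : V) :
    forceProb G Z u ≤ forceProb G Z' u := by
  unfold forceProb
  gcongr
  exact Set.toFinite _

lemma blueSet_mono {Z Z' : Set V} (h : Z ⊆ Z') (ω : RunSpace V) (t : ℕ) :
    blueSet G Z ω t ⊆ blueSet G Z' ω t := by
  induction t with
  | zero => exact h
  | succ t ih =>
    rintro w (hw | ⟨u, hu, huw, hη⟩)
    · exact Or.inl (ih hw)
    · exact Or.inr ⟨u, ih hu, huw, hη.trans (forceProb_mono ih u)⟩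

lemma measurable_of_finite_set {β : Type*} [MeasurableSpace β] (f : Set V → β) : Measurable f :=
  fun s _ => (Set.toFinite (f ⁻¹' s)).measurableSet

lemma measurable_blueSet (Z : Set V) (t : ℕ) :
    Measurable fun ω : RunSpace V => blueSet G Z ω t := by
  induction t with
  | zero => exact measurable_const
  | succ t ih =>
    refine measurable_set_iff.2 fun w => ?_
    have h_mem := measurable_set_iff.1 ih
    refine (h_mem w).or (Measurable.exists fun u => (h_mem u).and (measurable_const.and ?_))
    exact measurableSet_setOfPred.1 (measurableSet_le (by fun_prop)
      ((measurable_of_finite_set fun Z => forceProb G Z u).comp ih))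

lemma measurable_afterRound (Z : Set V) : Measurable fun η => afterRound G Z η := by
  refine measurable_set_iff.2 fun w => measurable_const.or (Measurable.exists fun u =>
    measurable_const.and (measurable_const.and ?_))
  exact measurableSet_setOfPred.1 (measurableSet_le (by fun_prop) measurable_const)

lemma measurableSet_not_subset_blueSet (Z B : Set V) (t : ℕ) :
    MeasurableSet {ω : RunSpace V | ¬ B ⊆ blueSet G Z ω t} :=
  measurable_blueSet Z t (Set.toFinite {S : Set V | ¬ B ⊆ S}).measurableSet

lemma failProb_mono {Z Z' B B' : Set V} (hZ : Z ⊆ Z') (hB : B' ⊆ B) (t : ℕ) :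
    failProb G Z' B' t ≤ failProb G Z B t :=
  measureReal_mono fun ω hω hs => hω (hB.trans (hs.trans (blueSet_mono hZ ω t)))

lemma integrable_failProb_afterRound (Z B : Set V) (t : ℕ) :
    Integrable (fun η => failProb G (afterRound G Z η) B t) (roundMeasure V) := by
  refine Integrable.of_bound ((measurable_of_finite_set fun Z => failProb G Z B t).comp
    (measurable_afterRound Z)).aestronglyMeasurable 1 (Eventually.of_forall fun η => ?_)
  rw [Real.norm_of_nonneg (failProb_nonneg _ _ _)]
  exact failProb_le_one _ _ _

lemma failProb_succ (Z B : Set V) (t : ℕ) :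
    failProb G Z B (t + 1) = ∫ η, failProb G (afterRound G Z η) B t ∂(roundMeasure V) := by
  have hm := measurableSet_not_subset_blueSet (G := G) Z B (t + 1)
  have hm' := measurable_consRound hm
  rw [failProb, measureReal_def, ← measurePreserving_consRound.measure_preimage
    hm.nullMeasurableSet, Measure.prod_apply hm',
    ← integral_toReal (measurable_measure_prodMk_left hm').aemeasurable
      (Eventually.of_forall fun _ => measure_lt_top _ _)]
  simp only [failProb, measureReal_def, Set.preimage_ofPred_eq, blueSet_consRound]

lemma failProb_add (Z A B : Set V) (s t : ℕ) :
    failProb G Z B (s + t) ≤ failProb G Z A s + failProb G A B t := by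
  induction s generalizing Z with
  | zero =>
    rw [Nat.zero_add]
    by_cases h : A ⊆ Z
    · rw [failProb_eq_zero h, zero_add]
      exact failProb_mono h subset_rfl t
    · rw [failProb_zero h]
      exact (failProb_le_one Z B t).trans (le_add_of_nonneg_right (failProb_nonneg A B t))
  | succ s ih =>
    have h_int := integrable_failProb_afterRound (G := G) Z A s
    calc failProb G Z B (s + 1 + t)
        = ∫ η, failProb G (afterRound G Z η) B (s + t) ∂(roundMeasure V) := by
          rw [Nat.add_right_comm, failProb_succ]
      _ ≤ ∫ η, (failProb G (afterRound G Z η) A s + failProb G A B t) ∂(roundMeasure V) :=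
          integral_mono (integrable_failProb_afterRound _ _ _)
            (h_int.add (integrable_const _)) fun η => ih _
      _ = failProb G Z A (s + 1) + failProb G A B t := by
          rw [integral_add h_int (integrable_const _), ← failProb_succ]
          simp

end Rounds

section BoundedDegree

variable {V : Type*} {G : SimpleGraph V}

lemma roundMeasure_real_apply_le (e : V × V) (c : unitInterval) :
    (roundMeasure V).real {η | η e ≤ c} = c := by
  have h_vol : (roundMeasure V) {η | η e ≤ c} = volume (Set.Iic c) :=
    (measurePreserving_eval_infinitePi (fun _ => volume) e).measure_preimage
      measurableSet_Iic.nullMeasurableSet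
  simp [measureReal_def, h_vol, unitInterval.volume_Iic, c.2.1]

lemma integral_ite_apply_le (e : V × V) (c : unitInterval) (a b : ℝ) :
    ∫ η, (if η e ≤ c then a else b) ∂(roundMeasure V) = c * a + (1 - c) * b := by
  have hm : MeasurableSet {η : V × V → unitInterval | η e ≤ c} :=
    measurableSet_le (measurable_pi_apply e) measurable_const
  have h_ind : (fun η : V × V → unitInterval => if η e ≤ c then a else b) =
      fun η => b + Set.indicator {η | η e ≤ c} (fun _ => a - b) η := by
    ext η
    by_cases h : η e ≤ c <;> simp [h]
  rw [h_ind, integral_add (integrable_const _) ((integrable_const _).indicator hm),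
    integral_indicator_const _ hm, roundMeasure_real_apply_le]
  simp only [integral_const, probReal_univ, smul_eq_mul]
  ring

variable [Finite V] {Δ : ℕ}

lemma one_div_le_forceProb (hΔ : ∀ u, (G.neighborSet u).ncard ≤ Δ) {Z : Set V} {u w : V}
    (hu : u ∈ Z) (huw : G.Adj u w) : 1 / (Δ : ℝ) ≤ forceProb G Z u := by
  have h_blue : (1 : ℝ) ≤ (insert u (G.neighborSet u) ∩ Z).ncard :=
    mod_cast (Set.ncard_pos).2 ⟨u, Set.mem_insert _ _, hu⟩
  have h_deg : (0 : ℝ) < (G.neighborSet u).ncard := mod_cast (Set.ncard_pos).2 ⟨w, huw⟩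
  have h_le : ((G.neighborSet u).ncard : ℝ) ≤ Δ := mod_cast hΔ u
  unfold forceProb
  gcongr

lemma failProb_succ_le_of_attempt {Z B : Set V} {t : ℕ} {e : V × V} {c : unitInterval} {a b : ℝ}
    (ha : ∀ η, η e ≤ c → failProb G (afterRound G Z η) B t ≤ a)
    (hb : ∀ η, failProb G (afterRound G Z η) B t ≤ b) :
    failProb G Z B (t + 1) ≤ c * a + (1 - c) * b := by
  have h_meas : Measurable fun η : V × V → unitInterval => if η e ≤ c then a else b :=
    Measurable.ite (measurableSet_le (measurable_pi_apply e) measurable_const)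
      measurable_const measurable_const
  have h_int : Integrable (fun η => if η e ≤ c then a else b) (roundMeasure V) := by
    refine .of_bound h_meas.aestronglyMeasurable (max |a| |b|) (.of_forall fun η => ?_)
    split_ifs
    exacts [le_max_left _ _, le_max_right _ _]
  rw [failProb_succ, ← integral_ite_apply_le]
  refine integral_mono (integrable_failProb_afterRound _ _ _) h_int fun η => ?_
  dsimp only
  split_ifs with hη
  exacts [ha η hη, hb η]

/-- The bound solves the recursion in which, in every round, the distance still to be covered
drops by one with probability `1 / Δ`. -/
lemma failProb_le_of_walk (hΔ₁ : 1 ≤ Δ) (hΔ : ∀ u, (G.neighborSet u).ncard ≤ Δ) (T : ℕ)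
    {Z : Set V} {z w : V} (hz : z ∈ Z) (p : G.Walk z w) :
    failProb G Z {w} T ≤ Δ ^ p.length * (1 - 1 / Δ + 1 / Δ ^ 2 : ℝ) ^ T := by
  have hΔ₁' : (1 : ℝ) ≤ Δ := mod_cast hΔ₁
  have h_inv : (1 / Δ : ℝ) ∈ Set.Icc 0 1 := ⟨by positivity, div_le_one_of_le₀ hΔ₁' (by positivity)⟩
  obtain ⟨q, hq⟩ : ∃ q : ℝ, q = 1 - 1 / Δ + 1 / Δ ^ 2 := ⟨_, rfl⟩
  rw [← hq]
  induction T generalizing Z z with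
  | zero =>
    rw [pow_zero, mul_one]
    exact (failProb_le_one _ _ _).trans (one_le_pow₀ hΔ₁')
  | succ T ih =>
    cases p with
    | nil =>
      have hq₀ : 0 ≤ q := hq ▸ add_nonneg (sub_nonneg.2 h_inv.2) (by positivity)
      rw [failProb_eq_zero (by simpa using hz)]
      positivity
    | @cons _ x _ hzx p =>
      calc failProb G Z {w} (T + 1)
          ≤ 1 / Δ * (Δ ^ p.length * q ^ T) + (1 - 1 / Δ) * (Δ ^ (p.length + 1) * q ^ T) :=
            failProb_succ_le_of_attempt (e := (z, x)) (c := ⟨1 / Δ, h_inv⟩)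
              (fun η hη => ih (Or.inr
                ⟨z, hz, hzx, le_trans hη (one_div_le_forceProb hΔ hz hzx)⟩) p)
              fun η => ih (subset_afterRound _ _ hz) (.cons hzx p)
        _ = Δ ^ (p.length + 1) * (q ^ T * (1 - 1 / Δ + 1 / Δ ^ 2)) := by
            field_simp
            ring
        _ = Δ ^ (SimpleGraph.Walk.cons hzx p).length * q ^ (T + 1) := by
            rw [SimpleGraph.Walk.length_cons, pow_succ q, hq]

lemma failProb_le_of_dist (hΔ₁ : 1 ≤ Δ) (hΔ : ∀ u, (G.neighborSet u).ncard ≤ Δ)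
    (hG : G.Connected) {Z B : Set V} {D : ℕ} (hB : ∀ w ∈ B, ∃ z ∈ Z, G.dist z w ≤ D) (T : ℕ) :
    failProb G Z B T ≤ Nat.card V * (Δ ^ D * (1 - 1 / Δ + 1 / Δ ^ 2 : ℝ) ^ T) := by
  have hΔ₁' : (1 : ℝ) ≤ Δ := mod_cast hΔ₁
  have hq₀ : (0 : ℝ) ≤ 1 - 1 / Δ + 1 / Δ ^ 2 :=
    add_nonneg (sub_nonneg.2 (div_le_one_of_le₀ hΔ₁' (by positivity))) (by positivity)
  cases nonempty_fintype V
  have h_vertex : ∀ w ∈ B.toFinite.toFinset,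
      failProb G Z {w} T ≤ Δ ^ D * (1 - 1 / Δ + 1 / Δ ^ 2 : ℝ) ^ T := by
    intro w hw
    obtain ⟨z, hz, hD⟩ := hB w (by simpa using hw)
    obtain ⟨p, hp⟩ := hG.exists_walk_length_eq_dist z w
    refine (failProb_le_of_walk hΔ₁ hΔ T hz p).trans ?_
    rw [hp]
    gcongr
  calc failProb G Z B T ≤ failProb G Z (⋃ w ∈ B.toFinite.toFinset, {w}) T :=
        failProb_mono subset_rfl (fun w hw => by simpa using hw) _
    _ ≤ ∑ w ∈ B.toFinite.toFinset, failProb G Z {w} T := failProb_biUnion_le _ _ _ _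
    _ ≤ B.toFinite.toFinset.card • (Δ ^ D * (1 - 1 / Δ + 1 / Δ ^ 2 : ℝ) ^ T) :=
        Finset.sum_le_card_nsmul _ _ _ h_vertex
    _ ≤ Nat.card V * (Δ ^ D * (1 - 1 / Δ + 1 / Δ ^ 2 : ℝ) ^ T) := by
        rw [nsmul_eq_mul, Nat.card_eq_fintype_card]
        gcongr
        exact Finset.card_le_univ _

end BoundedDegree

section FiniteChain

open Matrix

lemma exists_forall_tendsto_of_eventually_mem_Icc {S : Type*} [Nonempty S]
    {u : ℕ → S → ℝ}
    (hu : ∀ ε > 0, ∃ a b, b - a < ε ∧ ∀ᶠ t in atTop, ∀ x, u t x ∈ Set.Icc a b) :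
    ∃ l, ∀ x, Tendsto (fun t => u t x) atTop (𝓝 l) := by
  have h_cauchy : Cauchy (map (Function.uncurry u) (atTop ×ˢ ⊤)) := by
    refine Metric.cauchy_iff.2 ⟨inferInstance, fun ε hε => ?_⟩
    obtain ⟨a, b, hab, h_mem⟩ := hu ε hε
    refine ⟨Set.Icc a b, (h_mem.prod_inl ⊤).mono fun p hp => hp p.2, fun y hy z hz => ?_⟩
    exact (Real.dist_le_of_mem_Icc hy hz).trans_lt hab
  obtain ⟨l, hl⟩ := CompleteSpace.complete h_cauchy
  exact ⟨l, fun x => Tendsto.comp (f := fun t : ℕ => (t, x)) hl (tendsto_id.prodMk tendsto_top)⟩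

variable {S : Type*} [Fintype S] [DecidableEq S] {P : Matrix S S ℝ}

lemma sum_mul_sub_eq_mulVec_sub (hP : P ∈ rowStochastic ℝ S) (f : S → ℝ) (a : ℝ) (x : S) :
    ∑ y, P x y * (f y - a) = (P *ᵥ f) x - a := by
  simp_rw [mul_sub, Finset.sum_sub_distrib, ← Finset.sum_mul,
    sum_row_of_mem_rowStochastic hP, one_mul]
  rfl

lemma mul_sub_le_mulVec_sub (hP : P ∈ rowStochastic ℝ S) {f : S → ℝ} {a c : ℝ} {w x : S}
    (hc : c ≤ P x w) (hf : ∀ y, a ≤ f y) : c * (f w - a) ≤ (P *ᵥ f) x - a :=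
  calc c * (f w - a) ≤ P x w * (f w - a) :=
        mul_le_mul_of_nonneg_right hc (sub_nonneg.2 (hf w))
    _ ≤ ∑ y, P x y * (f y - a) :=
        Finset.single_le_sum (f := fun y => P x y * (f y - a)) (fun y _ =>
          mul_nonneg (nonneg_of_mem_rowStochastic hP) (sub_nonneg.2 (hf y))) (Finset.mem_univ w)
    _ = (P *ᵥ f) x - a := sum_mul_sub_eq_mulVec_sub hP f a x

lemma mulVec_mem_Icc_of_le_column (hP : P ∈ rowStochastic ℝ S) {w : S} {c : ℝ}
    (hw : ∀ x, c ≤ P x w) {f : S → ℝ} {a b : ℝ} (hf : ∀ x, f x ∈ Set.Icc a b) (x : S) :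
    (P *ᵥ f) x ∈ Set.Icc (a + c * (f w - a)) (b - c * (b - f w)) := by
  have h_lower := mul_sub_le_mulVec_sub hP (hw x) fun y => (hf y).1
  have h_upper := mul_sub_le_mulVec_sub hP (f := -f) (hw x) fun y => neg_le_neg (hf y).2
  rw [mulVec_neg] at h_upper
  simp only [Pi.neg_apply] at h_upper
  exact ⟨by linarith, by linarith⟩

lemma mulVec_mem_Icc (hP : P ∈ rowStochastic ℝ S) {f : S → ℝ} {a b : ℝ}
    (hf : ∀ x, f x ∈ Set.Icc a b) (x : S) : (P *ᵥ f) x ∈ Set.Icc a b := by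
  simpa using mulVec_mem_Icc_of_le_column hP (w := x) (c := 0)
    (fun _ => nonneg_of_mem_rowStochastic hP) hf x

lemma exists_pow_mulVec_mem_Icc (hP : P ∈ rowStochastic ℝ S) {w : S} {m : ℕ} {c : ℝ}
    (hw : ∀ x, c ≤ (P ^ m) x w) {f : S → ℝ} {a b : ℝ} (hf : ∀ x, f x ∈ Set.Icc a b) (k : ℕ) :
    ∃ a' b', b' - a' = (1 - c) ^ k * (b - a) ∧
      ∀ t ≥ m * k, ∀ x, (P ^ t *ᵥ f) x ∈ Set.Icc a' b' := by
  induction k with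
  | zero => exact ⟨a, b, by simp, fun t _ x => mulVec_mem_Icc (pow_mem hP t) hf x⟩
  | succ k ih =>
    obtain ⟨a', b', h_len, h_mem⟩ := ih
    set g := P ^ (m * k) *ᵥ f with hg
    have h_contract := mulVec_mem_Icc_of_le_column (pow_mem hP m) hw (h_mem (m * k) le_rfl)
    refine ⟨a' + c * (g w - a'), b' - c * (b' - g w), ?_, fun t ht x => ?_⟩
    · rw [pow_succ', mul_assoc, ← h_len]
      ring
    · obtain ⟨s, rfl⟩ := Nat.exists_eq_add_of_le' ht
      have h_split : P ^ (s + m * (k + 1)) *ᵥ f = P ^ s *ᵥ (P ^ m *ᵥ g) := by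
        rw [hg, mulVec_mulVec, mulVec_mulVec, ← pow_add, ← pow_add, mul_add_one, add_comm (m * k),
          add_assoc]
      rw [h_split]
      exact mulVec_mem_Icc (pow_mem hP s) h_contract x

lemma exists_tendsto_pow_mulVec (hP : P ∈ rowStochastic ℝ S) {w : S} {m : ℕ} {c : ℝ}
    (hc : 0 < c) (hw : ∀ x, c ≤ (P ^ m) x w) (f : S → ℝ) :
    ∃ l : ℝ, ∀ x, Tendsto (fun t : ℕ => (P ^ t *ᵥ f) x) atTop (𝓝 l) := by
  have : Nonempty S := ⟨w⟩
  have hc₁ : c ≤ 1 := (hw w).trans (le_one_of_mem_rowStochastic (pow_mem hP m))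
  obtain ⟨b, hb⟩ := Finite.exists_le fun x => |f x|
  refine exists_forall_tendsto_of_eventually_mem_Icc fun ε hε => ?_
  have h_len : Tendsto (fun k : ℕ => (1 - c) ^ k * (b - -b)) atTop (𝓝 0) := by
    simpa using (tendsto_pow_atTop_nhds_zero_of_lt_one (sub_nonneg.2 hc₁)
      (sub_lt_self 1 hc)).mul_const (b - -b)
  obtain ⟨k, hk⟩ := (h_len.eventually (gt_mem_nhds hε)).exists
  obtain ⟨a', b', h_eq, h_mem⟩ :=
    exists_pow_mulVec_mem_Icc hP hw (fun x => abs_le.1 (hb x)) k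
  exact ⟨a', b', h_eq ▸ hk, (eventually_ge_atTop (m * k)).mono h_mem⟩

lemma exists_isStationary_isLimiting (hP : P ∈ rowStochastic ℝ S) {w : S} {m : ℕ} {c : ℝ}
    (hc : 0 < c) (hw : ∀ x, c ≤ (P ^ m) x w) : ∃ π, IsStationary P π ∧ IsLimiting P π := by
  choose π hπ using fun y => exists_tendsto_pow_mulVec hP hc hw (Pi.single y 1)
  simp only [mulVec_single_one] at hπ
  refine ⟨π, ⟨fun y => ?_, ?_, ?_⟩, fun x y => hπ y x⟩
  · exact ge_of_tendsto' (hπ y w) fun t => nonneg_of_mem_rowStochastic (pow_mem hP t)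
  · refine tendsto_nhds_unique (tendsto_finsetSum Finset.univ fun y _ => hπ y w) ?_
    exact tendsto_const_nhds.congr fun t => (sum_row_of_mem_rowStochastic (pow_mem hP t) w).symm
  · ext y
    refine tendsto_nhds_unique ?_ ((hπ y w).comp (tendsto_add_atTop_nat 1))
    refine (tendsto_finsetSum Finset.univ fun z _ => (hπ z w).mul_const (P z y)).congr fun t => ?_
    simp [pow_succ, mul_apply]

lemma IsLimiting.eq_dotProduct_of_mulVec_eq {π g : S → ℝ} (hl : IsLimiting P π)
    (hg : P *ᵥ g = g) (x : S) : g x = π ⬝ᵥ g := by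
  have h_pow : ∀ t : ℕ, P ^ t *ᵥ g = g := by
    intro t
    induction t with
    | zero => simp
    | succ t ih => rw [pow_succ, ← mulVec_mulVec, hg, ih]
  have h_lim : Tendsto (fun t : ℕ => (P ^ t *ᵥ g) x) atTop (𝓝 (π ⬝ᵥ g)) :=
    tendsto_finsetSum Finset.univ fun y _ => (hl x y).mul_const (g y)
  simp_rw [h_pow] at h_lim
  exact tendsto_nhds_unique tendsto_const_nhds h_lim

/-- The matrix `1 - P + 𝟙 ⊗ π` (the inverse of the fundamental matrix of the chain) is injective,
hence surjective, and its preimage of `f` solves the Poisson equation when `π ⬝ᵥ f = 0`. -/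
lemma exists_poisson_solution {π f : S → ℝ} (hs : IsStationary P π) (hl : IsLimiting P π)
    (hf : π ⬝ᵥ f = 0) : ∃ h : S → ℝ, f + P *ᵥ h = h := by
  set A : Matrix S S ℝ := 1 - P + vecMulVec 1 π
  have h_apply : ∀ g, A *ᵥ g = g - P *ᵥ g + (π ⬝ᵥ g) • 1 := fun g => by
    rw [add_mulVec, sub_mulVec, one_mulVec, vecMulVec_mulVec, op_smul_eq_smul]
  have h_mean : ∀ g, π ⬝ᵥ (A *ᵥ g) = π ⬝ᵥ g := fun g => by
    rw [h_apply, dotProduct_add, dotProduct_sub, dotProduct_mulVec, hs.2.2, dotProduct_smul,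
      dotProduct_one, hs.2.1]
    simp
  have h_inj : Function.Injective A.mulVec := by
    refine (injective_iff_map_eq_zero A.mulVecLin).2 fun g hg => ?_
    rw [mulVecLin_apply] at hg
    have h_zero : π ⬝ᵥ g = 0 := by rw [← h_mean, hg, dotProduct_zero]
    rw [h_apply, h_zero, zero_smul, add_zero, sub_eq_zero] at hg
    ext x
    rw [hl.eq_dotProduct_of_mulVec_eq hg.symm, h_zero, Pi.zero_apply]
  obtain ⟨h, rfl⟩ := mulVec_surjective_iff_isUnit.2 (mulVec_injective_iff_isUnit.1 h_inj) f
  rw [h_mean] at hf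
  exact ⟨h, by rw [h_apply, hf, zero_smul, add_zero, sub_add_cancel]⟩

end FiniteChain

section WindowChain

variable {d : ℕ}

/-- The randomness of one step of the window chain: the colours of the next diagonal, and a fair
bit that decides ties. -/
abbrev Noise (d : ℕ) : Type := Config (d + 1) × Bool

/-- Whether the next window is `(u 0, …, u (d - 1))` when the next diagonal has the colours `U` and
`b` decides ties. -/
def PicksInit (U : Config (d + 1)) (b : Bool) : Prop :=
  blueCount (Fin.tail U : Config d) < blueCount (Fin.init U : Config d) ∨
    blueCount (Fin.init U : Config d) = blueCount (Fin.tail U : Config d) ∧ b = true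

instance (U : Config (d + 1)) (b : Bool) : Decidable (PicksInit U b) := by
  unfold PicksInit; infer_instance

/-- The configuration after the all white one, `b` deciding between two central positions. -/
def resetConfig (d : ℕ) (b : Bool) : Config d :=
  if d = 2 then allBlue d
  else if Odd d then threeBlue d ((d - 3) / 2)
  else if b then threeBlue d ((d - 4) / 2) else threeBlue d ((d - 2) / 2)

/-- The configuration that follows `C` in the window chain, as a function of the noise. -/
def nextConfig (C : Config d) (x : Noise d) : Config d :=
  if C = allWhite d then resetConfig d x.2
  else if PicksInit x.1 x.2 then Fin.init x.1 else Fin.tail x.1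

/-- The law of the noise of a step from the configuration `C`. -/
def noiseProb (C : Config d) (x : Noise d) : ℝ := diagProb C x.1 / 2

/-- The expectation of `g` under the law of the noise of a step from the configuration `C`. -/
def noiseMean (C : Config d) (g : Noise d → ℝ) : ℝ := ∑ x, noiseProb C x * g x

lemma turnBlueProb_mem_Icc (C : Config d) (k : Fin (d + 1)) :
    turnBlueProb C k ∈ Set.Icc (0 : ℝ) 1 :=
  ⟨sub_nonneg.2 (pow_le_one₀ (by norm_num) (by norm_num)), sub_le_self 1 (by positivity)⟩

lemma diagProb_nonneg (C : Config d) (U : Config (d + 1)) : 0 ≤ diagProb C U := by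
  refine Finset.prod_nonneg fun k _ => ?_
  split_ifs
  · exact (turnBlueProb_mem_Icc C k).1
  · exact sub_nonneg.2 (turnBlueProb_mem_Icc C k).2

lemma sum_diagProb (C : Config d) : ∑ U, diagProb C U = 1 := by
  have h_expand := Fintype.prod_sum
    (fun k (b : Bool) => if b = true then turnBlueProb C k else 1 - turnBlueProb C k)
  simpa [diagProb] using h_expand.symm

lemma noiseProb_nonneg (C : Config d) (x : Noise d) : 0 ≤ noiseProb C x :=
  div_nonneg (diagProb_nonneg _ _) (by norm_num)

lemma noiseMean_eq_sum_diagProb (C : Config d) (g : Noise d → ℝ) :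
    noiseMean C g = ∑ U, diagProb C U * ((g (U, true) + g (U, false)) / 2) := by
  rw [noiseMean, Fintype.sum_prod_type]
  refine Finset.sum_congr rfl fun U _ => ?_
  simp only [Fintype.sum_bool, noiseProb]
  ring

lemma noiseMean_const (C : Config d) (a : ℝ) : noiseMean C (fun _ => a) = a := by
  simp [noiseMean_eq_sum_diagProb, ← Finset.sum_mul, sum_diagProb]

lemma noiseMean_add (C : Config d) (f g : Noise d → ℝ) :
    noiseMean C (fun x => f x + g x) = noiseMean C f + noiseMean C g := by
  simp only [noiseMean, mul_add, Finset.sum_add_distrib]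

lemma noiseMean_const_mul (C : Config d) (a : ℝ) (g : Noise d → ℝ) :
    noiseMean C (fun x => a * g x) = a * noiseMean C g := by
  simp only [noiseMean, Finset.mul_sum, mul_left_comm]

lemma noiseMean_neg (C : Config d) (g : Noise d → ℝ) :
    noiseMean C (fun x => -g x) = -noiseMean C g := by
  simp only [noiseMean, mul_neg, Finset.sum_neg_distrib]

lemma noiseMean_mono {C : Config d} {f g : Noise d → ℝ} (h : ∀ x, f x ≤ g x) :
    noiseMean C f ≤ noiseMean C g :=
  Finset.sum_le_sum fun x _ => mul_le_mul_of_nonneg_left (h x) (noiseProb_nonneg C x)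

lemma windowChain_eq_noiseMean (C C' : Config d) :
    windowChain d C C' = noiseMean C fun x => if nextConfig C x = C' then 1 else 0 := by
  rw [noiseMean_eq_sum_diagProb]
  by_cases hC : C = allWhite d
  · simp only [windowChain, nextConfig, if_pos hC, ← Finset.sum_mul, sum_diagProb, one_mul]
    simp only [resetConfig, resetProb, eq_comm (a := C')]
    split_ifs <;> (simp_all; try norm_num)
  · rw [windowChain, if_neg hC]
    refine Finset.sum_congr rfl fun U _ => congrArg _ ?_
    simp only [nextConfig, if_neg hC, selectProb, PicksInit, eq_comm (a := C')]
    rcases lt_trichotomy (blueCount (Fin.init U : Config d)) (blueCount (Fin.tail U : Config d))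
      with h | h | h
    · simp [h, h.ne, h.not_gt]
    · simp only [h, lt_irrefl, if_false, false_or, true_and, if_true, Bool.false_eq_true]
      ring
    · simp [h, h.ne']

lemma windowChain_mulVec (g : Config d → ℝ) (C : Config d) :
    (windowChain d).mulVec g C = noiseMean C fun x => g (nextConfig C x) := by
  simp only [Matrix.mulVec, dotProduct, windowChain_eq_noiseMean, noiseMean, Finset.sum_mul]
  rw [Finset.sum_comm]
  simp

lemma windowChain_mem_rowStochastic : windowChain d ∈ Matrix.rowStochastic ℝ (Config d) := by
  refine Matrix.mem_rowStochastic.2 ⟨fun C C' => ?_, ?_⟩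
  · rw [windowChain_eq_noiseMean]
    exact (noiseMean_const C 0).symm.trans_le
      (noiseMean_mono fun x => by split_ifs <;> norm_num)
  · ext C
    simpa [noiseMean_const] using windowChain_mulVec (1 : Config d → ℝ) C

lemma ne_allWhite_iff {C : Config d} : C ≠ allWhite d ↔ ∃ i, C i = true := by
  rw [Function.ne_iff]
  simp [allWhite]

lemma blueCount_eq_zero_iff {C : Config d} : blueCount C = 0 ↔ C = allWhite d := by
  rw [blueCount, Finset.card_eq_zero, Finset.filter_eq_empty_iff, ← not_iff_not, ← Ne,
    ne_allWhite_iff]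
  simp

lemma eq_allWhite_of_init_of_tail (hd : 1 ≤ d) {U : Config (d + 1)}
    (h_init : (Fin.init U : Config d) = allWhite d)
    (h_tail : (Fin.tail U : Config d) = allWhite d) : U = allWhite (d + 1) := by
  ext i
  rcases Fin.eq_zero_or_eq_succ i with rfl | ⟨j, rfl⟩
  · exact congrFun h_init ⟨0, hd⟩
  · exact congrFun h_tail j

lemma nextConfig_ne_allWhite (hd : 1 ≤ d) {C : Config d} (hC : C ≠ allWhite d)
    {U : Config (d + 1)} (hU : U ≠ allWhite (d + 1)) (b : Bool) :
    nextConfig C (U, b) ≠ allWhite d := by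
  intro h
  have h_count : blueCount (Fin.init U : Config d) = 0 ∧ blueCount (Fin.tail U : Config d) = 0 := by
    rw [← blueCount_eq_zero_iff, nextConfig, if_neg hC] at h
    split_ifs at h with hp <;> (unfold PicksInit at hp; dsimp only at *; omega)
  exact hU (eq_allWhite_of_init_of_tail hd (blueCount_eq_zero_iff.1 h_count.1)
    (blueCount_eq_zero_iff.1 h_count.2))

lemma nextConfig_allWhite {C : Config d} (hC : C ≠ allWhite d) (b : Bool) :
    nextConfig C (allWhite (d + 1), b) = allWhite d := by
  simp only [nextConfig, if_neg hC]
  split_ifs <;> rfl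

lemma resetConfig_ne_allWhite (hd : 2 ≤ d) (b : Bool) : resetConfig d b ≠ allWhite d := by
  rw [ne_allWhite_iff]
  unfold resetConfig
  split_ifs with h_two h_odd
  · exact ⟨⟨0, by omega⟩, rfl⟩
  · obtain ⟨r, hr⟩ := h_odd
    exact ⟨⟨(d - 3) / 2, by omega⟩, by simp [threeBlue]⟩
  · exact ⟨⟨(d - 4) / 2, by omega⟩, by simp [threeBlue]⟩
  · exact ⟨⟨(d - 2) / 2, by omega⟩, by simp [threeBlue]⟩

lemma windowChain_allWhite_of_ne (hd : 1 ≤ d) {C : Config d} (hC : C ≠ allWhite d) :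
    windowChain d C (allWhite d) = (1 / 4) ^ ∑ k, blueNbrs C k := by
  rw [windowChain_eq_noiseMean, noiseMean_eq_sum_diagProb,
    Finset.sum_eq_single (allWhite (d + 1))]
  · simp only [nextConfig_allWhite hC]
    simp [diagProb, allWhite, turnBlueProb, Finset.prod_pow_eq_pow_sum]
  · intro U _ hU
    simp [nextConfig_ne_allWhite hd hC hU]
  · simp

lemma sum_blueNbrs (C : Config d) : ∑ k, blueNbrs C k = 2 * ∑ i, (C i).toNat := by
  simp only [blueNbrs, Finset.sum_add_distrib]
  rw [Fin.sum_univ_succ, Fin.sum_univ_castSucc (n := d)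
    (f := fun k => ((Fin.snoc C false : Config (d + 1)) k).toNat)]
  simp [two_mul]

lemma two_le_sum_blueNbrs {C : Config d} (hC : C ≠ allWhite d) : 2 ≤ ∑ k, blueNbrs C k := by
  obtain ⟨i, hi⟩ := ne_allWhite_iff.1 hC
  have h_one : (C i).toNat ≤ ∑ i, (C i).toNat :=
    Finset.single_le_sum (f := fun i => (C i).toNat) (fun _ _ => Nat.zero_le _) (Finset.mem_univ i)
  rw [hi, Bool.toNat_true] at h_one
  rw [sum_blueNbrs]
  omega

lemma windowChain_allWhite_le (hd : 2 ≤ d) (C : Config d) :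
    windowChain d C (allWhite d) ≤ 1 / 16 := by
  by_cases hC : C = allWhite d
  · have h_zero : windowChain d C (allWhite d) = 0 := by
      simp [windowChain_eq_noiseMean, nextConfig, hC, resetConfig_ne_allWhite hd, noiseMean_const]
    rw [h_zero]
    norm_num
  · calc windowChain d C (allWhite d) = (1 / 4) ^ ∑ k, blueNbrs C k :=
          windowChain_allWhite_of_ne (by omega) hC
      _ ≤ (1 / 4) ^ 2 :=
          pow_le_pow_of_le_one (by norm_num) (by norm_num) (two_le_sum_blueNbrs hC)
      _ = 1 / 16 := by norm_num

lemma windowChain_sq_allWhite_pos (hd : 2 ≤ d) (C : Config d) :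
    0 < (windowChain d ^ 2) C (allWhite d) := by
  have h_nonneg : ∀ C C', 0 ≤ windowChain d C C' := fun _ _ =>
    Matrix.nonneg_of_mem_rowStochastic windowChain_mem_rowStochastic
  obtain ⟨C', hC', h_pos⟩ : ∃ C', C' ≠ allWhite d ∧ 0 < windowChain d C C' := by
    by_contra! hc
    have h_sum := Matrix.sum_row_of_mem_rowStochastic (windowChain_mem_rowStochastic (d := d)) C
    rw [Finset.sum_eq_single (allWhite d) (fun C' _ h => le_antisymm (hc C' h) (h_nonneg C C'))
      (by simp)] at h_sum
    linarith [windowChain_allWhite_le hd C]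
  rw [pow_two, Matrix.mul_apply]
  refine lt_of_lt_of_le (mul_pos h_pos ?_) (Finset.single_le_sum
    (f := fun C' => windowChain d C C' * windowChain d C' (allWhite d))
    (fun C' _ => mul_nonneg (h_nonneg C C') (h_nonneg C' _)) (Finset.mem_univ C'))
  rw [windowChain_allWhite_of_ne (by omega) hC']
  positivity

lemma exists_isStationary_isLimiting_windowChain (hd : 2 ≤ d) :
    ∃ π, IsStationary (windowChain d) π ∧ IsLimiting (windowChain d) π := by
  obtain ⟨C, hC⟩ := Finite.exists_min fun C => (windowChain d ^ 2) C (allWhite d)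
  exact exists_isStationary_isLimiting windowChain_mem_rowStochastic
    (windowChain_sq_allWhite_pos hd C) hC

lemma stationary_allWhite_le (hd : 2 ≤ d) {π : Config d → ℝ}
    (hs : IsStationary (windowChain d) π) : π (allWhite d) ≤ 1 / 16 :=
  calc π (allWhite d) = ∑ C, π C * windowChain d C (allWhite d) :=
        (congrFun hs.2.2 (allWhite d)).symm
    _ ≤ ∑ C, π C * (1 / 16) := Finset.sum_le_sum fun C _ =>
        mul_le_mul_of_nonneg_left (windowChain_allWhite_le hd C) (hs.1 C)
    _ = 1 / 16 := by rw [← Finset.sum_mul, hs.2.1, one_mul]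

end WindowChain

section Reflection

variable {d : ℕ}

/-- The position of some blue vertex of the configuration (`0` if there is none). -/
def someBlue (C : Config d) : ℤ :=
  open Classical in if h : ∃ i, C i = true then ((h.choose : ℕ) : ℤ) else 0

/-- A choice of a blue position for each value of the tie-breaking bit, such that reflecting the
configuration and flipping the bit reflects the position. -/
def pickBlue (C : Config d) (b : Bool) : ℤ :=
  if b then someBlue C else d - 1 - someBlue (C ∘ Fin.rev)

/-- Twice the displacement of the centre of the window relative to the diagonal direction during a
step of the window chain. When the window turns white, the new window is placed around a position
that was blue before. -/
def shift (C : Config d) (x : Noise d) : ℤ :=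
  if C = allWhite d then (if Odd d then 0 else if x.2 then 1 else -1)
  else if x.1 = allWhite (d + 1) then 2 * pickBlue C x.2 - (d - 1)
  else if PicksInit x.1 x.2 then -1 else 1

/-- The reflection of a configuration, as a permutation. -/
def revConfig : Config d ≃ Config d := Equiv.arrowCongr Fin.revPerm (Equiv.refl Bool)

lemma revConfig_apply (C : Config d) : revConfig C = C ∘ Fin.rev := rfl

/-- The reflection of the noise, which reverses the diagonal and flips the tie-breaking bit. -/
def revNoise : Noise d ≃ Noise d := revConfig.prodCongr Equiv.boolNot

lemma revNoise_apply (U : Config (d + 1)) (b : Bool) : revNoise (U, b) = (U ∘ Fin.rev, !b) := rfl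

lemma comp_rev_eq_allWhite {C : Config d} : C ∘ Fin.rev = allWhite d ↔ C = allWhite d :=
  (Fin.rev_surjective.injective_comp_right).eq_iff' rfl

lemma blueNbrs_rev (C : Config d) (k : Fin (d + 1)) :
    blueNbrs (C ∘ Fin.rev) k = blueNbrs C (Fin.rev k) := by
  have h_cons := congrFun (Fin.cons_comp_rev (α := Bool) (a := false) (f := C)) k
  have h_snoc := congrFun (Fin.snoc_comp_rev (α := Bool) (a := false) (f := C)) k
  simp only [Function.comp_apply] at h_cons h_snoc
  rw [blueNbrs, blueNbrs, h_cons, h_snoc, add_comm]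

lemma diagProb_rev (C : Config d) (U : Config (d + 1)) :
    diagProb (C ∘ Fin.rev) (U ∘ Fin.rev) = diagProb C U := by
  simp only [diagProb, turnBlueProb, blueNbrs_rev, Function.comp_apply]
  exact Equiv.prod_comp Fin.revPerm fun k =>
    if U k = true then 1 - (1 / 4 : ℝ) ^ blueNbrs C k else 1 - (1 - (1 / 4) ^ blueNbrs C k)

lemma init_rev (U : Config (d + 1)) :
    (Fin.init (U ∘ Fin.rev) : Config d) = (Fin.tail U : Config d) ∘ Fin.rev := by
  ext i
  simp [Fin.init, Fin.tail, Fin.rev_castSucc]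

lemma tail_rev (U : Config (d + 1)) :
    (Fin.tail (U ∘ Fin.rev) : Config d) = (Fin.init U : Config d) ∘ Fin.rev := by
  ext i
  simp [Fin.init, Fin.tail, Fin.rev_succ]

lemma blueCount_rev (C : Config d) : blueCount (C ∘ Fin.rev) = blueCount C :=
  Finset.card_equiv Fin.revPerm fun i => by simp

lemma picksInit_rev (U : Config (d + 1)) (b : Bool) :
    PicksInit (U ∘ Fin.rev) (!b) ↔ ¬ PicksInit U b := by
  unfold PicksInit
  rw [init_rev, tail_rev, blueCount_rev, blueCount_rev]
  cases b <;> simp <;> omega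

lemma threeBlue_rev {a b : ℕ} (h : a + b + 3 = d) :
    threeBlue d a ∘ Fin.rev = threeBlue d b := by
  ext i
  have hi := i.2
  simp only [threeBlue, Function.comp_apply, Fin.val_rev, decide_eq_decide]
  omega

lemma resetConfig_not (hd : 2 ≤ d) (b : Bool) :
    resetConfig d (!b) = resetConfig d b ∘ Fin.rev := by
  unfold resetConfig
  by_cases h_two : d = 2
  · simp only [if_pos h_two]
    rfl
  by_cases h_odd : Odd d
  · simp only [if_neg h_two, if_pos h_odd]
    obtain ⟨r, hr⟩ := h_odd
    exact (threeBlue_rev (by omega)).symm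
  · simp only [if_neg h_two, if_neg h_odd]
    obtain ⟨r, hr⟩ := Nat.not_odd_iff_even.1 h_odd
    cases b
    · exact (threeBlue_rev (by omega)).symm
    · exact (threeBlue_rev (by omega)).symm

lemma nextConfig_rev (hd : 2 ≤ d) (C : Config d) (x : Noise d) :
    nextConfig (C ∘ Fin.rev) (revNoise x) = nextConfig C x ∘ Fin.rev := by
  obtain ⟨U, b⟩ := x
  simp only [revNoise_apply, nextConfig, comp_rev_eq_allWhite, picksInit_rev]
  split_ifs
  · exact resetConfig_not hd b
  · rw [tail_rev]
  · rw [init_rev]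

lemma pickBlue_rev (C : Config d) (b : Bool) :
    pickBlue (C ∘ Fin.rev) (!b) = d - 1 - pickBlue C b := by
  have h_rev : (C ∘ Fin.rev) ∘ Fin.rev = C := by ext i; simp
  cases b <;> simp [pickBlue, h_rev]

lemma shift_rev (C : Config d) (x : Noise d) :
    shift (C ∘ Fin.rev) (revNoise x) = -shift C x := by
  obtain ⟨U, b⟩ := x
  simp only [revNoise_apply, shift, comp_rev_eq_allWhite, picksInit_rev, pickBlue_rev]
  split_ifs <;> (simp_all; try ring)

lemma noiseMean_rev (C : Config d) (g : Noise d → ℝ) :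
    noiseMean (C ∘ Fin.rev) g = noiseMean C (g ∘ revNoise) := by
  rw [noiseMean, ← Equiv.sum_comp revNoise]
  exact Finset.sum_congr rfl fun ⟨U, b⟩ _ => by simp [revNoise_apply, noiseProb, diagProb_rev]

lemma windowChain_rev (hd : 2 ≤ d) (C C' : Config d) :
    windowChain d (C ∘ Fin.rev) (C' ∘ Fin.rev) = windowChain d C C' := by
  simp only [windowChain_eq_noiseMean, noiseMean_rev, Function.comp_def (g := revNoise),
    nextConfig_rev hd, (Fin.rev_surjective.injective_comp_right).eq_iff]

lemma IsLimiting.apply_equiv {S : Type*} [Fintype S] [DecidableEq S] {P : Matrix S S ℝ}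
    {π : S → ℝ} (hl : IsLimiting P π) (e : S ≃ S) (he : ∀ x y, P (e x) (e y) = P x y) (x : S) :
    π (e x) = π x := by
  have h_pow : ∀ (t : ℕ) (x y : S), (P ^ t) (e x) (e y) = (P ^ t) x y := by
    intro t
    induction t with
    | zero => simp [Matrix.one_apply]
    | succ t ih =>
      intro x y
      rw [pow_succ, Matrix.mul_apply, Matrix.mul_apply, ← Equiv.sum_comp e]
      simp only [ih, he]
  refine tendsto_nhds_unique (hl (e x) (e x)) ?_
  simp_rw [h_pow]
  exact hl x x

lemma dotProduct_noiseMean_shift (hd : 2 ≤ d) {π : Config d → ℝ}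
    (hl : IsLimiting (windowChain d) π) :
    π ⬝ᵥ (fun C => noiseMean C fun x => (shift C x : ℝ)) = 0 := by
  have h_mean : ∀ C : Config d, noiseMean (C ∘ Fin.rev) (fun x => (shift (C ∘ Fin.rev) x : ℝ)) =
      -noiseMean C fun x => (shift C x : ℝ) := fun C => by
    simp [noiseMean_rev, Function.comp_def (g := revNoise), shift_rev, noiseMean_neg]
  have h_π : ∀ C : Config d, π (C ∘ Fin.rev) = π C := hl.apply_equiv revConfig (windowChain_rev hd)
  have h_rev := Equiv.sum_comp revConfig
    fun C => π C * noiseMean C fun x => (shift C x : ℝ)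
  simp only [revConfig_apply, h_π, h_mean, mul_neg, Finset.sum_neg_distrib] at h_rev
  rw [dotProduct]
  linarith

end Reflection

section Correctors

open Matrix

variable {d : ℕ} {π : Config d → ℝ}

/-- `h` corrects the increment `f` of an additive functional of the window chain: adding `h` of the
current configuration to the functional gives a martingale. The bound `β` controls `h` and the
increments of the martingale. -/
structure IsCorrector (f : Config d → Noise d → ℝ) (h : Config d → ℝ) (β : ℝ) : Prop where
  mean_eq : ∀ C, noiseMean C (fun x => f C x + h (nextConfig C x)) = h C
  abs_apply_le : ∀ C, |h C| ≤ β
  abs_step_le : ∀ C x, |f C x + h (nextConfig C x) - h C| ≤ β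

lemma IsCorrector.mono {f : Config d → Noise d → ℝ} {h : Config d → ℝ} {β β' : ℝ}
    (hh : IsCorrector f h β) (hβ : β ≤ β') : IsCorrector f h β' :=
  ⟨hh.mean_eq, fun C => (hh.abs_apply_le C).trans hβ, fun C x => (hh.abs_step_le C x).trans hβ⟩

lemma exists_isCorrector (hs : IsStationary (windowChain d) π)
    (hl : IsLimiting (windowChain d) π) {f : Config d → Noise d → ℝ}
    (hf : π ⬝ᵥ (fun C => noiseMean C (f C)) = 0) : ∃ h β, IsCorrector f h β := by
  obtain ⟨h, hh⟩ := exists_poisson_solution hs hl hf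
  obtain ⟨β₁, h₁⟩ := (Set.finite_range fun C => |h C|).bddAbove
  obtain ⟨β₂, h₂⟩ := (Set.finite_range fun p : Config d × Noise d =>
    |f p.1 p.2 + h (nextConfig p.1 p.2) - h p.1|).bddAbove
  refine ⟨h, max β₁ β₂, fun C => ?_, fun C => (h₁ ⟨C, rfl⟩).trans (le_max_left _ _),
    fun C x => (h₂ ⟨(C, x), rfl⟩).trans (le_max_right _ _)⟩
  rw [noiseMean_add, ← windowChain_mulVec]
  exact congrFun hh C

lemma IsCorrector.noiseMean_sq_le {f : Config d → Noise d → ℝ} {h : Config d → ℝ} {β : ℝ}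
    (hh : IsCorrector f h β) (C : Config d) (z : ℝ) :
    noiseMean C (fun x => (z + f C x + h (nextConfig C x)) ^ 2) ≤ (z + h C) ^ 2 + β ^ 2 := by
  have h_sq : ∀ x, (z + f C x + h (nextConfig C x)) ^ 2 ≤
      2 * (z + h C) * (f C x + h (nextConfig C x)) + ((z + h C) * (z - h C) + β ^ 2) := fun x => by
    have h_step := sq_le_sq' (abs_le.1 (hh.abs_step_le C x)).1 (abs_le.1 (hh.abs_step_le C x)).2
    linarith
  calc noiseMean C (fun x => (z + f C x + h (nextConfig C x)) ^ 2)
    _ ≤ _ := noiseMean_mono h_sq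
    _ = (z + h C) ^ 2 + β ^ 2 := by
      rw [noiseMean_add, noiseMean_const_mul, hh.mean_eq, noiseMean_const]
      ring

/-- The level increment of the window during a step of the chain. -/
def levelStep (C : Config d) : ℤ := if C = allWhite d then -1 else 1

/-- The number of rounds that a step of the chain takes. -/
def timeStep (C : Config d) : ℕ := if C = allWhite d then 0 else 1

/-- The deviation of the level increment from motion at speed `γ`. -/
def levelDefect (γ : ℝ) (C : Config d) : ℝ := levelStep C - γ * timeStep C

lemma dotProduct_levelDefect (hs : IsStationary (windowChain d) π) (hμ : π (allWhite d) ≠ 1) :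
    π ⬝ᵥ levelDefect ((1 - 2 * π (allWhite d)) / (1 - π (allWhite d))) = 0 := by
  set γ := (1 - 2 * π (allWhite d)) / (1 - π (allWhite d)) with hγ
  have h_split : ∀ C, π C * levelDefect γ C =
      π C * (1 - γ) + if C = allWhite d then π C * (γ - 2) else 0 := fun C => by
    unfold levelDefect levelStep timeStep
    split_ifs
    · simp
      ring
    · simp
  have h_ne : 1 - π (allWhite d) ≠ 0 := sub_ne_zero.2 hμ.symm
  simp only [dotProduct, h_split, Finset.sum_add_distrib, ← Finset.sum_mul, hs.2.1,
    Finset.sum_ite_eq', Finset.mem_univ, if_true]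
  rw [hγ]
  field_simp
  ring

lemma exists_correctors (hd : 2 ≤ d) (hs : IsStationary (windowChain d) π)
    (hl : IsLimiting (windowChain d) π) :
    ∃ (lev trans : Config d → ℝ) (β : ℝ),
      IsCorrector (fun C _ => levelDefect ((1 - 2 * π (allWhite d)) / (1 - π (allWhite d))) C)
        lev β ∧ IsCorrector (fun C x => (shift C x : ℝ)) trans β := by
  have hμ := stationary_allWhite_le hd hs
  obtain ⟨lev, β₁, h_lev⟩ := exists_isCorrector hs hl
    (f := fun C _ => levelDefect ((1 - 2 * π (allWhite d)) / (1 - π (allWhite d))) C)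
    (by simpa only [noiseMean_const] using dotProduct_levelDefect hs (by linarith))
  obtain ⟨trans, β₂, h_trans⟩ := exists_isCorrector hs hl (dotProduct_noiseMean_shift hd hl)
  exact ⟨lev, trans, max β₁ β₂, h_lev.mono (le_max_left _ _), h_trans.mono (le_max_right _ _)⟩

/-- The squared distance of the corrected position of the window, at level `k` and transversal
coordinate `y`, from the point that it should reach in the remaining `T` rounds at speed `γ`,
plus the variance that is still to come. The last term pays for the variance of the step after the
configuration has turned white, which takes no round. -/
def lyapunov (lev trans : Config d → ℝ) (γ β K : ℝ) (C : Config d) (y k : ℤ) (T : ℕ) : ℝ :=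
  (k + γ * T + lev C - K) ^ 2 + (y + trans C) ^ 2 + 4 * β ^ 2 * T +
    if C = allWhite d then 2 * β ^ 2 else 0

variable {lev trans : Config d → ℝ} {γ β K : ℝ} {C : Config d} {y k : ℤ} {T : ℕ}

lemma lyapunov_nonneg : 0 ≤ lyapunov lev trans γ β K C y k T := by
  unfold lyapunov
  split_ifs <;> positivity

lemma abs_lt_of_lyapunov_lt {L : ℝ} (hL : 0 ≤ L) (h_lev : |lev C| ≤ β) (h_trans : |trans C| ≤ β)
    (h : lyapunov lev trans γ β K C y k T < L ^ 2) :
    |k + γ * T - K| < L + β ∧ |(y : ℝ)| < L + β := by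
  have h_white : 0 ≤ if C = allWhite d then 2 * β ^ 2 else 0 := by split_ifs <;> positivity
  have h_var : 0 ≤ 4 * β ^ 2 * T := by positivity
  unfold lyapunov at h
  have h_level : |k + γ * T + lev C - K| < L := by
    refine abs_lt_of_sq_lt_sq ?_ hL
    linarith [sq_nonneg (y + trans C)]
  have h_pos : |y + trans C| < L := by
    refine abs_lt_of_sq_lt_sq ?_ hL
    linarith [sq_nonneg (k + γ * T + lev C - K)]
  rw [abs_lt] at h_level h_pos ⊢
  rw [abs_lt]
  rw [abs_le] at h_lev h_trans
  refine ⟨⟨?_, ?_⟩, ⟨?_, ?_⟩⟩ <;> linarith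

lemma noiseMean_white_penalty_le (hd : 2 ≤ d) (C : Config d) {a : ℝ} (ha : 0 ≤ a) :
    noiseMean C (fun x => if nextConfig C x = allWhite d then a else 0) ≤
      if C = allWhite d then 0 else a := by
  split_ifs with hC
  · simp [nextConfig, hC, resetConfig_ne_allWhite hd, noiseMean_const]
  · exact (noiseMean_mono fun x => by split_ifs <;> simp [ha]).trans_eq (noiseMean_const C a)

lemma noiseMean_lyapunov_le (hd : 2 ≤ d) (h_lev : IsCorrector (fun C _ => levelDefect γ C) lev β)
    (h_trans : IsCorrector (fun C x => (shift C x : ℝ)) trans β) (K : ℝ) (C : Config d) (y k : ℤ)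
    (T : ℕ) :
    noiseMean C (fun x =>
        lyapunov lev trans γ β K (nextConfig C x) (y + shift C x) (k + levelStep C) T) ≤
      lyapunov lev trans γ β K C y k (T + timeStep C) := by
  set z : ℝ := k + γ * (T + timeStep C : ℕ) - K with hz
  have h_split : ∀ x,
      lyapunov lev trans γ β K (nextConfig C x) (y + shift C x) (k + levelStep C) T =
        (z + levelDefect γ C + lev (nextConfig C x)) ^ 2 +
          (y + shift C x + trans (nextConfig C x)) ^ 2 + 4 * β ^ 2 * T +
          if nextConfig C x = allWhite d then 2 * β ^ 2 else 0 := fun x => by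
    rw [lyapunov, hz, levelDefect]
    push_cast
    ring
  simp only [h_split, noiseMean_add, noiseMean_const]
  have h_level := h_lev.noiseMean_sq_le C z
  have h_pos := h_trans.noiseMean_sq_le C y
  have h_white := noiseMean_white_penalty_le hd C (a := 2 * β ^ 2) (by positivity)
  have h_target : (z + lev C) ^ 2 + β ^ 2 + ((y + trans C) ^ 2 + β ^ 2) + 4 * β ^ 2 * T +
      (if C = allWhite d then 0 else 2 * β ^ 2) =
        lyapunov lev trans γ β K C y k (T + timeStep C) := by
    rw [lyapunov, hz, timeStep]
    split_ifs <;> (push_cast; ring)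
  linarith

end Correctors

section Chart

variable {V : Type*} {G : SimpleGraph V} {φ : ℤ × ℤ → V} {lo hi : ℤ}

/-- `φ` identifies the square `[lo - 1, hi + 1]²` of the square lattice with a set of vertices of
`G`, and all neighbours of the vertices of `[lo, hi]²` are the neighbours in the lattice. -/
structure IsChart (G : SimpleGraph V) (φ : ℤ × ℤ → V) (lo hi : ℤ) : Prop where
  injOn : Set.InjOn φ (Set.Icc (lo - 1) (hi + 1) ×ˢ Set.Icc (lo - 1) (hi + 1))
  neighborSet_eq : ∀ i ∈ Set.Icc lo hi, ∀ j ∈ Set.Icc lo hi,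
    G.neighborSet (φ (i, j)) = φ '' {(i + 1, j), (i - 1, j), (i, j + 1), (i, j - 1)}

lemma IsChart.swap (hφ : IsChart G φ lo hi) : IsChart G (φ ∘ Prod.swap) lo hi where
  injOn := hφ.injOn.comp Prod.swap_injective.injOn fun _ hp => ⟨hp.2, hp.1⟩
  neighborSet_eq i hi j hj := by
    rw [Function.comp_apply, Prod.swap_prod_mk, hφ.neighborSet_eq j hj i hi, Set.image_comp]
    congr 1
    simp only [Set.image_insert_eq, Set.image_singleton, Prod.swap_prod_mk]
    grind

lemma IsChart.eq_of_apply_eq (hφ : IsChart G φ lo hi) {i j i' j' : ℤ}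
    (h_i : i ∈ Set.Icc (lo - 1) (hi + 1)) (h_j : j ∈ Set.Icc (lo - 1) (hi + 1))
    (h_i' : i' ∈ Set.Icc (lo - 1) (hi + 1)) (h_j' : j' ∈ Set.Icc (lo - 1) (hi + 1))
    (h : φ (i, j) = φ (i', j')) : i = i' ∧ j = j' :=
  Prod.mk.inj (hφ.injOn ⟨h_i, h_j⟩ ⟨h_i', h_j'⟩ h)

variable {i j : ℤ}

lemma IsChart.adj_up (hφ : IsChart G φ lo hi) (h_i : i ∈ Set.Icc lo hi)
    (h_j : j ∈ Set.Icc lo hi) : G.Adj (φ (i, j)) (φ (i, j + 1)) := by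
  rw [← SimpleGraph.mem_neighborSet, hφ.neighborSet_eq i h_i j h_j]
  exact Set.mem_image_of_mem φ (by simp)

lemma IsChart.ncard_neighborSet_le (hφ : IsChart G φ lo hi) (h_i : i ∈ Set.Icc lo hi)
    (h_j : j ∈ Set.Icc lo hi) : (G.neighborSet (φ (i, j))).ncard ≤ 4 := by
  rw [hφ.neighborSet_eq i h_i j h_j]
  refine (Set.ncard_image_le (Set.toFinite _)).trans ?_
  have h_card := Finset.card_le_four (a := (i + 1, j)) (b := (i - 1, j)) (c := (i, j + 1))
    (d := (i, j - 1))
  rw [← Set.ncard_coe_finset] at h_card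
  simpa using h_card

lemma IsChart.card_div_four_le_forceProb [Finite V] (hφ : IsChart G φ lo hi)
    (h_i : i ∈ Set.Icc lo hi) (h_j : j ∈ Set.Icc lo hi) {Z : Set V} {s : Finset (ℤ × ℤ)}
    (hs : (s : Set (ℤ × ℤ)) ⊆ {(i, j), (i + 1, j), (i - 1, j), (i, j + 1), (i, j - 1)})
    (hZ : ∀ p ∈ s, φ p ∈ Z) : (s.card : ℝ) / 4 ≤ forceProb G Z (φ (i, j)) := by
  have h_inj : Set.InjOn φ s := hφ.injOn.mono fun p hp => by
    simp only [Set.mem_Icc] at h_i h_j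
    rcases hs hp with rfl | rfl | rfl | rfl | rfl <;>
      exact ⟨⟨by omega, by omega⟩, ⟨by omega, by omega⟩⟩
  have h_sub : φ '' s ⊆ insert (φ (i, j)) (G.neighborSet (φ (i, j))) ∩ Z := by
    refine Set.subset_inter ?_ (Set.image_subset_iff.2 hZ)
    rw [hφ.neighborSet_eq i h_i j h_j, ← Set.image_insert_eq]
    exact Set.image_mono hs
  have h_card : s.card ≤ (insert (φ (i, j)) (G.neighborSet (φ (i, j))) ∩ Z).ncard := by
    rw [← Set.ncard_coe_finset, ← h_inj.ncard_image]
    exact Set.ncard_le_ncard h_sub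
  have h_pos : 0 < (G.neighborSet (φ (i, j))).ncard :=
    (Set.ncard_pos (Set.toFinite _)).2 ⟨_, hφ.adj_up h_i h_j⟩
  have h_deg : ((G.neighborSet (φ (i, j))).ncard : ℝ) ≤ 4 := by
    exact_mod_cast hφ.ncard_neighborSet_le h_i h_j
  unfold forceProb
  gcongr

/-- The vertices of the band `|i - j| ≤ M` that are dominated by `(i, j)` and not below the
level `b` are all blue. -/
def ConeBlue (φ : ℤ × ℤ → V) (M b : ℤ) (Z : Set V) (i j : ℤ) : Prop :=
  ∀ i' j', i' ≤ i → j' ≤ j → i' - j' ≤ M → j' - i' ≤ M → b ≤ i' + j' → φ (i', j') ∈ Z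

/-- The position `(i, j)` lies inside the band `|i - j| ≤ M`, above the level `b` and inside the
square `[lo, hi]²`, far enough from the boundaries for its blue cone to grow. -/
structure IsInterior (lo hi M b i j : ℤ) : Prop where
  two_mul_lo_le : 2 * lo ≤ b - M
  lt_hi : i < hi
  lt_hi' : j < hi
  sub_le : i - j + 2 ≤ M
  sub_le' : j - i + 2 ≤ M
  le_add : b + 2 * M + 4 ≤ i + j

variable {M b : ℤ} {Z : Set V}

lemma IsInterior.swap (h : IsInterior lo hi M b i j) : IsInterior lo hi M b j i :=
  ⟨h.1, h.3, h.2, h.5, h.4, by linarith [h.6]⟩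

lemma ConeBlue.mono {Z' : Set V} (h : ConeBlue φ M b Z i j) (hZ : Z ⊆ Z') :
    ConeBlue φ M b Z' i j :=
  fun i' j' h₁ h₂ h₃ h₄ h₅ => hZ (h i' j' h₁ h₂ h₃ h₄ h₅)

lemma ConeBlue.swap (h : ConeBlue φ M b Z i j) : ConeBlue (φ ∘ Prod.swap) M b Z j i :=
  fun i' j' h₁ h₂ h₃ h₄ h₅ => h j' i' h₂ h₁ h₄ h₃ (by omega)

variable [Finite V]

lemma ConeBlue.one_le_forceProb (hφ : IsChart G φ lo hi) (h : ConeBlue φ M b Z i j)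
    (h_int : IsInterior lo hi M b i j) {i' : ℤ} (hi' : i' < i) (h_band : j + 1 - i' ≤ M) :
    1 ≤ forceProb G Z (φ (i', j)) := by
  obtain ⟨h_lo, h_hi, h_hi', h_sub, -, h_b⟩ := h_int
  have h_card : ({(i', j), (i' + 1, j), (i' - 1, j), (i', j - 1)} : Finset (ℤ × ℤ)).card = 4 := by
    grind
  have h_force := hφ.card_div_four_le_forceProb (i := i') (j := j) (Z := Z)
    (s := {(i', j), (i' + 1, j), (i' - 1, j), (i', j - 1)}) ⟨by omega, by omega⟩
    ⟨by omega, by omega⟩ (by grind) ?_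
  · rw [h_card] at h_force
    norm_num at h_force
    exact h_force
  · simp only [Finset.mem_insert, Finset.mem_singleton]
    rintro p (rfl | rfl | rfl | rfl) <;>
      exact h _ _ (by omega) (by omega) (by omega) (by omega) (by omega)

lemma ConeBlue.three_div_four_le_forceProb (hφ : IsChart G φ lo hi) (h : ConeBlue φ M b Z i j)
    (h_int : IsInterior lo hi M b i j) : 3 / 4 ≤ forceProb G Z (φ (i, j)) := by
  obtain ⟨h_lo, h_hi, h_hi', h_sub, h_sub', h_b⟩ := h_int
  have h_card : ({(i, j), (i - 1, j), (i, j - 1)} : Finset (ℤ × ℤ)).card = 3 := by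
    grind
  have h_force := hφ.card_div_four_le_forceProb (i := i) (j := j) (Z := Z)
    (s := {(i, j), (i - 1, j), (i, j - 1)}) ⟨by omega, by omega⟩ ⟨by omega, by omega⟩
    (by grind) ?_
  · rw [h_card] at h_force
    exact_mod_cast h_force
  · simp only [Finset.mem_insert, Finset.mem_singleton]
    rintro p (rfl | rfl | rfl) <;>
      exact h _ _ (by omega) (by omega) (by omega) (by omega) (by omega)

lemma ConeBlue.upLeft (hφ : IsChart G φ lo hi) (h : ConeBlue φ M b Z i j)
    (h_int : IsInterior lo hi M b i j) (η : V × V → unitInterval) :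
    ConeBlue φ M b (afterRound G Z η) (i - 1) (j + 1) := by
  intro i' j' h₁ h₂ h₃ h₄ h₅
  have ⟨h_lo, h_hi, h_hi', h_sub, _, h_b⟩ := h_int
  rcases h₂.lt_or_eq with h_lt | rfl
  · exact subset_afterRound _ _ (h i' j' (by omega) (by omega) h₃ h₄ h₅)
  · refine Or.inr ⟨φ (i', j), h _ _ (by omega) le_rfl (by omega) (by omega) (by omega),
      hφ.adj_up ⟨by omega, by omega⟩ ⟨by omega, by omega⟩, (η _).2.2.trans ?_⟩
    exact h.one_le_forceProb hφ h_int (by omega) h₄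

lemma ConeBlue.up (hφ : IsChart G φ lo hi) (h : ConeBlue φ M b Z i j)
    (h_int : IsInterior lo hi M b i j) {η : V × V → unitInterval}
    (hη : (η (φ (i, j), φ (i, j + 1)) : ℝ) ≤ 3 / 4) :
    ConeBlue φ M b (afterRound G Z η) i (j + 1) := by
  intro i' j' h₁ h₂ h₃ h₄ h₅
  rcases h₁.lt_or_eq with h_lt | rfl
  · exact h.upLeft hφ h_int η i' j' (by omega) h₂ h₃ h₄ h₅
  rcases h₂.lt_or_eq with h_lt | rfl
  · exact subset_afterRound _ _ (h i' j' le_rfl (by omega) h₃ h₄ h₅)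
  · have ⟨h_lo, h_hi, h_hi', h_sub, h_sub', h_b⟩ := h_int
    exact Or.inr ⟨φ (i', j), h _ _ le_rfl le_rfl (by omega) (by omega) (by omega),
      hφ.adj_up ⟨by omega, by omega⟩ ⟨by omega, by omega⟩,
      hη.trans (h.three_div_four_le_forceProb hφ h_int)⟩

lemma ConeBlue.downRight (hφ : IsChart G φ lo hi) (h : ConeBlue φ M b Z i j)
    (h_int : IsInterior lo hi M b i j) (η : V × V → unitInterval) :
    ConeBlue φ M b (afterRound G Z η) (i + 1) (j - 1) :=
  (h.swap.upLeft hφ.swap h_int.swap η).swap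

lemma ConeBlue.right (hφ : IsChart G φ lo hi) (h : ConeBlue φ M b Z i j)
    (h_int : IsInterior lo hi M b i j) {η : V × V → unitInterval}
    (hη : (η (φ (i, j), φ (i + 1, j)) : ℝ) ≤ 3 / 4) :
    ConeBlue φ M b (afterRound G Z η) (i + 1) j :=
  (h.swap.up hφ.swap h_int.swap hη).swap

end Chart

section DiagonalLaw

variable {V : Type*} {G : SimpleGraph V} {φ : ℤ × ℤ → V} {lo hi : ℤ} {d : ℕ}

/-- The colours of the two parents of `u s` on the window, for `true` the previous vertex of the
window and for `false` the next one. -/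
def parentBlue (C : Config d) (s : Fin (d + 1)) (b : Bool) : Bool :=
  if b then (Fin.cons false C : Config (d + 1)) s else (Fin.snoc C false : Config (d + 1)) s

/-- The attempts of the two parents of `u s` on `u s`, for the window that occupies the positions
`(a, k - a), …, (a + d - 1, k - a - d + 1)` of the level `k`. -/
def attempt (φ : ℤ × ℤ → V) (a k : ℤ) (s : Fin (d + 1)) (b : Bool) : V × V :=
  (φ (if b then (a + s - 1, k + 1 - a - s) else (a + s, k - a - s)), φ (a + s, k + 1 - a - s))

/-- The colours of the next diagonal if each attempt succeeds with probability `3 / 4` only. -/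
def diagOf (φ : ℤ × ℤ → V) (C : Config d) (a k : ℤ) (η : V × V → unitInterval) : Config (d + 1) :=
  fun s => open Classical in decide
    (∃ b, parentBlue C s b = true ∧ (η (attempt φ a k s b) : ℝ) ≤ 3 / 4)

lemma measurableSet_forall_imp_lt {ι : Type*} [Countable ι] (c : ι → Bool) (p : ℝ) :
    MeasurableSet {x : ι → unitInterval | ∀ i, c i = true → p < x i} :=
  measurableSet_setOfPred.2 <| Measurable.forall fun i => measurable_const.imp <|
    measurableSet_setOfPred.1 (measurableSet_lt measurable_const (by fun_prop))

lemma real_forall_imp_lt {ι : Type*} [Fintype ι] (c : ι → Bool) (p : unitInterval) :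
    (Measure.infinitePi fun _ : ι => (volume : Measure unitInterval)).real
      {x | ∀ i, c i = true → (p : ℝ) < x i} = (1 - p) ^ ∑ i, (c i).toNat := by
  have h_pi : {x : ι → unitInterval | ∀ i, c i = true → (p : ℝ) < x i} =
      Set.pi Set.univ fun i => if c i = true then Set.Ioi p else Set.univ := by
    ext x
    simp only [Set.mem_ofPred_eq, Set.mem_univ_pi]
    refine forall_congr' fun i => ?_
    split_ifs with hc <;> simp [hc]
  rw [h_pi, measureReal_def, Measure.infinitePi_eq_pi, Measure.pi_pi, ENNReal.toReal_prod,
    ← Finset.prod_pow_eq_pow_sum]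
  refine Finset.prod_congr rfl fun i _ => ?_
  cases c i
  · simp
  · simp [unitInterval.volume_Ioi, p.2.2]

lemma preimage_diagOf (φ : ℤ × ℤ → V) (C : Config d) (a k : ℤ) (U : Config (d + 1)) :
    diagOf φ C a k ⁻¹' {U} = (fun η s b => η (attempt φ a k s b)) ⁻¹'
      Set.pi Set.univ fun s =>
        if U s = true then {x | ∀ b, parentBlue C s b = true → (3 / 4 : ℝ) < x b}ᶜ
        else {x | ∀ b, parentBlue C s b = true → (3 / 4 : ℝ) < x b} := by
  ext η
  simp only [Set.mem_preimage, Set.mem_singleton_iff, Set.mem_univ_pi, funext_iff]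
  refine forall_congr' fun s => ?_
  cases U s
  · simp [diagOf]
  · simp only [diagOf, decide_eq_true_iff, if_true, Set.mem_compl_iff, Set.mem_ofPred_eq,
      not_forall, not_lt, exists_prop]

lemma measurable_diagOf (φ : ℤ × ℤ → V) (C : Config d) (a k : ℤ) :
    Measurable (diagOf φ C a k) := by
  refine measurable_to_countable' fun U => ?_
  rw [preimage_diagOf]
  refine MeasurableSet.preimage (MeasurableSet.univ_pi fun s => ?_) (by fun_prop)
  split_ifs
  · exact (measurableSet_forall_imp_lt _ _).compl
  · exact measurableSet_forall_imp_lt _ _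

lemma IsChart.injective_attempt (hφ : IsChart G φ lo hi) {a k : ℤ}
    (ha : a ∈ Set.Icc lo (hi - d)) (hk : k - a ∈ Set.Icc (lo + d) (hi - 1)) :
    Function.Injective fun e : Fin (d + 1) × Bool => attempt φ a k e.1 e.2 := by
  simp only [Set.mem_Icc] at ha hk
  rintro ⟨s, b⟩ ⟨s', b'⟩ h
  obtain ⟨h_parent, h_child⟩ := Prod.mk.inj h
  dsimp only at h_parent h_child
  have hs := s.is_le
  have hs' := s'.is_le
  obtain rfl : s = s' := by
    have h_eq := hφ.eq_of_apply_eq ⟨by omega, by omega⟩ ⟨by omega, by omega⟩ ⟨by omega, by omega⟩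
      ⟨by omega, by omega⟩ h_child
    ext
    omega
  cases b <;> cases b' <;> try rfl
  all_goals
    have h_eq := hφ.eq_of_apply_eq ⟨by omega, by omega⟩ ⟨by omega, by omega⟩ ⟨by omega, by omega⟩
      ⟨by omega, by omega⟩ h_parent
    omega

lemma map_infinitePi_curry_of_injective {ι α β X : Type*} [MeasurableSpace X] (μ : Measure X)
    [IsProbabilityMeasure μ] {e : α → β → ι} (he : Function.Injective fun p : α × β => e p.1 p.2) :
    (Measure.infinitePi fun _ : ι => μ).map (fun η a b => η (e a b)) =
      Measure.infinitePi fun _ : α => Measure.infinitePi fun _ : β => μ := by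
  have h_curry := Measure.infinitePi_map_curry fun (_ : α) (_ : β) => μ
  rw [← Measure.map_infinitePi_infinitePi_of_inj (P := fun _ : ι => μ) he,
    Measure.map_map (by fun_prop) (by fun_prop)] at h_curry
  exact h_curry

lemma IsChart.roundMeasure_real_diagOf (hφ : IsChart G φ lo hi) {a k : ℤ}
    (ha : a ∈ Set.Icc lo (hi - d)) (hk : k - a ∈ Set.Icc (lo + d) (hi - 1)) (C : Config d)
    (U : Config (d + 1)) : (roundMeasure V).real (diagOf φ C a k ⁻¹' {U}) = diagProb C U := by
  set W : Fin (d + 1) → Set (Bool → unitInterval) := fun s =>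
    {x | ∀ b, parentBlue C s b = true → (3 / 4 : ℝ) < x b}
  have h_meas : ∀ s, MeasurableSet (W s) := fun s => measurableSet_forall_imp_lt _ _
  have h_meas' : ∀ s, MeasurableSet (if U s = true then (W s)ᶜ else W s) := fun s => by
    split_ifs
    exacts [(h_meas s).compl, h_meas s]
  have h_real : ∀ s, (Measure.infinitePi fun _ : Bool => (volume : Measure unitInterval)).real
      (W s) = (1 / 4) ^ blueNbrs C s := fun s => by
    rw [show (1 / 4 : ℝ) = 1 - 3 / 4 by norm_num]
    exact (real_forall_imp_lt (parentBlue C s) ⟨3 / 4, by norm_num, by norm_num⟩).trans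
      (by rw [Fintype.sum_bool]; rfl)
  rw [preimage_diagOf, measureReal_def, ← Measure.map_apply (by fun_prop)
    (MeasurableSet.univ_pi h_meas'), roundMeasure,
    map_infinitePi_curry_of_injective _ (hφ.injective_attempt ha hk), Measure.infinitePi_eq_pi,
    Measure.pi_pi, ENNReal.toReal_prod]
  refine Finset.prod_congr rfl fun s _ => ?_
  rw [← measureReal_def, turnBlueProb, ← h_real]
  split_ifs
  · exact probReal_compl_eq_one_sub (h_meas s)
  · exact (sub_sub_cancel _ _).symm

lemma IsChart.integral_le_noiseMean (hφ : IsChart G φ lo hi) {a k : ℤ}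
    (ha : a ∈ Set.Icc lo (hi - d)) (hk : k - a ∈ Set.Icc (lo + d) (hi - 1)) (C : Config d)
    {F : (V × V → unitInterval) → ℝ} (hF : Integrable F (roundMeasure V)) {g : Noise d → ℝ}
    (hg : ∀ η b, F η ≤ g (diagOf φ C a k η, b)) :
    ∫ η, F η ∂(roundMeasure V) ≤ noiseMean C g := by
  set g' : Config (d + 1) → ℝ := fun U => (g (U, true) + g (U, false)) / 2 with hg'
  have h_meas := measurable_diagOf φ C a k
  have : IsProbabilityMeasure ((roundMeasure V).map (diagOf φ C a k)) :=
    Measure.isProbabilityMeasure_map h_meas.aemeasurable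
  have h_int : Integrable g' ((roundMeasure V).map (diagOf φ C a k)) := Integrable.of_finite
  calc ∫ η, F η ∂(roundMeasure V)
    _ ≤ ∫ η, g' (diagOf φ C a k η) ∂(roundMeasure V) :=
      integral_mono hF (h_int.comp_measurable h_meas) fun η => by
        simp only [hg']
        linarith [hg η true, hg η false]
    _ = ∫ U, g' U ∂((roundMeasure V).map (diagOf φ C a k)) :=
      (integral_map h_meas.aemeasurable h_int.aestronglyMeasurable).symm
    _ = ∑ U, diagProb C U * g' U := by
      simp only [integral_fintype h_int, map_measureReal_apply h_meas (MeasurableSet.singleton _),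
        hφ.roundMeasure_real_diagOf ha hk, smul_eq_mul]
    _ = noiseMean C g := (noiseMean_eq_sum_diagProb C g).symm

end DiagonalLaw

section Window

variable {V : Type*} {G : SimpleGraph V} {φ : ℤ × ℤ → V} {lo hi M b : ℤ} {d : ℕ} {Z : Set V}
  {C : Config d} {a y k : ℤ}

lemma someBlue_spec (hC : C ≠ allWhite d) : ∃ r : Fin d, C r = true ∧ someBlue C = (r : ℕ) := by
  have h := ne_allWhite_iff.1 hC
  exact ⟨h.choose, h.choose_spec, by rw [someBlue, dif_pos h]⟩

lemma pickBlue_spec (hC : C ≠ allWhite d) (c : Bool) :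
    ∃ r : Fin d, C r = true ∧ pickBlue C c = (r : ℕ) := by
  cases c
  · obtain ⟨r, h_blue, h_eq⟩ := someBlue_spec (comp_rev_eq_allWhite.not.2 hC)
    refine ⟨Fin.rev r, h_blue, ?_⟩
    simp only [pickBlue, h_eq, Fin.val_rev, Bool.false_eq_true, if_false]
    grind
  · obtain ⟨r, h_blue, h_eq⟩ := someBlue_spec hC
    exact ⟨r, h_blue, by simp [pickBlue, h_eq]⟩

lemma exists_centre_resetConfig (hd : 2 ≤ d) (x : Noise d) :
    ∃ e : ℤ, 2 * e + shift (allWhite d) x = d - 1 ∧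
      ∀ s : Fin d, resetConfig d x.2 s = true → e - 1 ≤ s ∧ (s : ℤ) ≤ e + 1 := by
  obtain ⟨U, c⟩ := x
  rw [shift, if_pos rfl]
  rcases Nat.even_or_odd' d with ⟨r, h_even | h_odd⟩
  · have h_not_odd : ¬ Odd d := Nat.not_odd_iff_even.2 ⟨r, by omega⟩
    cases c
    · refine ⟨r, by simp [h_not_odd]; omega, fun s hs => ?_⟩
      simp only [resetConfig, h_not_odd, if_false, Bool.false_eq_true] at hs
      split_ifs at hs with h_two
      · omega
      · have h_mem := of_decide_eq_true hs
        omega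
    · refine ⟨r - 1, by simp [h_not_odd]; omega, fun s hs => ?_⟩
      simp only [resetConfig, h_not_odd, if_false, if_true] at hs
      split_ifs at hs with h_two
      · omega
      · have h_mem := of_decide_eq_true hs
        omega
  · have h_odd' : Odd d := ⟨r, h_odd⟩
    refine ⟨r, by rw [if_pos h_odd']; omega, fun s hs => ?_⟩
    rw [resetConfig, if_neg (by omega), if_pos h_odd'] at hs
    have h_mem := of_decide_eq_true hs
    omega

/-- The blue vertices of the configuration `C`, placed on the window that occupies the positions
`(a, k - a), …, (a + d - 1, k - a - d + 1)` of the level `k`, have blue cones. -/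
def WindowBlue (φ : ℤ × ℤ → V) (M b : ℤ) (Z : Set V) (C : Config d) (a k : ℤ) : Prop :=
  ∀ s : Fin d, C s = true → ConeBlue φ M b Z (a + s) (k - a - s)

/-- The blue set `Z` realizes the state `C` of the chain at the level `k`, the centre of the window
having transversal coordinate `y`. In the all white state there are three consecutive vertices with
blue cones on the previous level. -/
def Realizes (φ : ℤ × ℤ → V) (M b : ℤ) (Z : Set V) (C : Config d) (y k : ℤ) : Prop :=
  if C = allWhite d then ∃ m, y = 2 * m - (k - 1) ∧
    ∀ i, m - 1 ≤ i → i ≤ m + 1 → ConeBlue φ M b Z i (k - 1 - i)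
  else ∃ a, y = 2 * a - k + d - 1 ∧ WindowBlue φ M b Z C a k

lemma Realizes.reset (hd : 2 ≤ d) (h : Realizes φ M b Z (allWhite d) y k) (x : Noise d) :
    Realizes φ M b Z (nextConfig (allWhite d) x) (y + shift (allWhite d) x)
      (k + levelStep (allWhite d)) := by
  rw [Realizes, if_pos rfl] at h
  obtain ⟨m, rfl, h_cone⟩ := h
  obtain ⟨e, h_centre, h_near⟩ := exists_centre_resetConfig hd x
  rw [nextConfig, if_pos rfl, levelStep, if_pos rfl, Realizes,
    if_neg (resetConfig_ne_allWhite hd x.2)]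
  refine ⟨m - e, by linarith, fun s hs => ?_⟩
  have ⟨h_ge, h_le⟩ := h_near s hs
  convert h_cone (m - e + s) (by omega) (by omega) using 1
  ring

lemma Realizes.target_mem {l : ℤ} (hC : C ≠ allWhite d) (h : Realizes φ M b Z C y k)
    (hk : 2 * l + M ≤ k) (hy : |y| ≤ M - d - 4) (hb : b ≤ 2 * l) : φ (l, l) ∈ Z := by
  rw [Realizes, if_neg hC] at h
  obtain ⟨a, rfl, h_window⟩ := h
  obtain ⟨s, hs⟩ := ne_allWhite_iff.1 hC
  rw [abs_le] at hy
  exact h_window s hs l l (by omega) (by omega) (by omega) (by omega) (by omega)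

/-- All positions of the window whose centre has the transversal coordinate `y` on the level `k`
are interior. -/
structure IsInteriorWindow (lo hi M b : ℤ) (d : ℕ) (y k : ℤ) : Prop where
  two_mul_lo_le : 2 * lo ≤ b - M
  le_two_mul_hi : k + M + 2 ≤ 2 * hi
  le_level : b + 2 * M + 4 ≤ k
  abs_le_sub : |y| ≤ M - d - 4

lemma IsInteriorWindow.isInterior (h : IsInteriorWindow lo hi M b d (2 * a - k + d - 1) k)
    (s : Fin d) : IsInterior lo hi M b (a + s) (k - a - s) := by
  obtain ⟨h_lo, h_hi, h_b, h_band⟩ := h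
  rw [abs_le] at h_band
  constructor <;> omega

variable {lev trans : Config d → ℝ} {γ β : ℝ}

lemma Realizes.mul_le_lyapunov_of_ne_allWhite (hd : 2 ≤ d)
    (h_lev : IsCorrector (fun C _ => levelDefect γ C) lev β)
    (h_trans : IsCorrector (fun C x => (shift C x : ℝ)) trans β) {K p : ℝ} {T : ℕ}
    (h_ne : ∀ C y k, C ≠ allWhite d → Realizes φ M b Z C y k →
      p ≤ lyapunov lev trans γ β K C y k T)
    (h : Realizes φ M b Z C y k) : p ≤ lyapunov lev trans γ β K C y k T := by
  by_cases hC : C = allWhite d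
  · subst hC
    calc p = noiseMean (allWhite d) (fun _ => p) := (noiseMean_const _ p).symm
      _ ≤ noiseMean (allWhite d) fun x => lyapunov lev trans γ β K (nextConfig (allWhite d) x)
            (y + shift (allWhite d) x) (k + levelStep (allWhite d)) T :=
        noiseMean_mono fun x => h_ne _ _ _
          (by rw [nextConfig, if_pos rfl]; exact resetConfig_ne_allWhite hd x.2) (h.reset hd x)
      _ ≤ lyapunov lev trans γ β K (allWhite d) y k (T + timeStep (allWhite d)) :=
        noiseMean_lyapunov_le hd h_lev h_trans K (allWhite d) y k T
      _ = lyapunov lev trans γ β K (allWhite d) y k T := by rw [timeStep, if_pos rfl, add_zero]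
  · exact h_ne C y k hC h

variable [Finite V]

lemma WindowBlue.next (hφ : IsChart G φ lo hi) (h : WindowBlue φ M b Z C a k)
    (h_int : IsInteriorWindow lo hi M b d (2 * a - k + d - 1) k) {η : V × V → unitInterval}
    {s : Fin (d + 1)} (hs : diagOf φ C a k η s = true) :
    ConeBlue φ M b (afterRound G Z η) (a + s) (k + 1 - a - s) := by
  obtain ⟨c, h_parent, hη⟩ := of_decide_eq_true hs
  cases c
  · rcases Fin.eq_castSucc_or_eq_last s with ⟨r, rfl⟩ | rfl
    · simp only [parentBlue, Bool.false_eq_true, if_false, Fin.snoc_castSucc] at h_parent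
      have h_eq : k + 1 - a - (r : ℤ) = k - a - r + 1 := by ring
      simp only [attempt, Bool.false_eq_true, if_false, Fin.val_castSucc, h_eq] at hη ⊢
      exact (h r h_parent).up hφ (h_int.isInterior r) hη
    · simp [parentBlue] at h_parent
  · rcases Fin.eq_zero_or_eq_succ s with rfl | ⟨r, rfl⟩
    · simp [parentBlue] at h_parent
    · simp only [parentBlue, if_true, Fin.cons_succ] at h_parent
      have h_right : a + ((r : ℤ) + 1) = a + r + 1 := by ring
      have h_height : k + 1 - a - ((r : ℤ) + 1) = k - a - r := by ring
      simp only [attempt, if_true, Fin.val_succ, Nat.cast_add, Nat.cast_one, h_right, h_height,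
        add_sub_cancel_right] at hη ⊢
      exact (h r h_parent).right hφ (h_int.isInterior r) hη

lemma WindowBlue.neighbors (hφ : IsChart G φ lo hi) (h : WindowBlue φ M b Z C a k)
    (h_int : IsInteriorWindow lo hi M b d (2 * a - k + d - 1) k) (η : V × V → unitInterval)
    {s : Fin d} (hs : C s = true) {i : ℤ} (h_ge : a + s - 1 ≤ i) (h_le : i ≤ a + s + 1) :
    ConeBlue φ M b (afterRound G Z η) i (k - i) := by
  obtain h_eq | h_eq | h_eq : i = a + s - 1 ∨ i = a + s ∨ i = a + s + 1 := by omega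
  · convert (h s hs).upLeft hφ (h_int.isInterior s) η using 1
    omega
  · convert (h s hs).mono (subset_afterRound _ _) using 1
    omega
  · convert (h s hs).downRight hφ (h_int.isInterior s) η using 1
    omega

lemma WindowBlue.realizes_next (hd : 1 ≤ d) (hφ : IsChart G φ lo hi) (hC : C ≠ allWhite d)
    (h : WindowBlue φ M b Z C a k)
    (h_int : IsInteriorWindow lo hi M b d (2 * a - k + d - 1) k) (η : V × V → unitInterval)
    (c : Bool) :
    Realizes φ M b (afterRound G Z η) (nextConfig C (diagOf φ C a k η, c))
      (2 * a - k + d - 1 + shift C (diagOf φ C a k η, c)) (k + levelStep C) := by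
  have h_next := fun s => h.next hφ h_int (η := η) (s := s)
  rw [levelStep, if_neg hC, shift, if_neg hC]
  set U := diagOf φ C a k η
  by_cases hU : U = allWhite (d + 1)
  · obtain ⟨r, hr, h_pick⟩ := pickBlue_spec hC c
    rw [hU, nextConfig_allWhite hC, Realizes, if_pos rfl, if_pos rfl, add_sub_cancel_right]
    exact ⟨a + r, by rw [h_pick]; ring, fun i => h.neighbors hφ h_int η hr⟩
  · rw [Realizes, if_neg (nextConfig_ne_allWhite hd hC hU c), if_neg hU, nextConfig, if_neg hC]
    split_ifs
    · exact ⟨a, by ring, fun s hs => h_next s.castSucc hs⟩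
    · refine ⟨a + 1, by ring, fun s hs => ?_⟩
      convert h_next s.succ hs using 1 <;> (rw [Fin.val_succ]; push_cast; ring)

lemma Realizes.failProb_succ_mul_le (hd : 1 ≤ d) (hφ : IsChart G φ lo hi) (hC : C ≠ allWhite d)
    (h : Realizes φ M b Z C y k) (h_int : IsInteriorWindow lo hi M b d y k) {B : Set V} {T : ℕ}
    {r : ℝ} {Λ : Config d → ℤ → ℤ → ℝ}
    (hΛ : ∀ Z' C' y' k', Realizes φ M b Z' C' y' k' → failProb G Z' B T * r ≤ Λ C' y' k') :
    failProb G Z B (T + 1) * r ≤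
      noiseMean C fun x => Λ (nextConfig C x) (y + shift C x) (k + levelStep C) := by
  rw [Realizes, if_neg hC] at h
  obtain ⟨a, rfl, h_window⟩ := h
  have ⟨h_lo, h_hi, h_b, h_band⟩ := h_int
  rw [abs_le] at h_band
  rw [failProb_succ, ← integral_mul_const]
  exact hφ.integral_le_noiseMean (a := a) (k := k) ⟨by omega, by omega⟩ ⟨by omega, by omega⟩ C
    ((integrable_failProb_afterRound Z B T).mul_const r) fun η c =>
      hΛ _ _ _ _ (h_window.realizes_next hd hφ hC h_int η c)

theorem Realizes.failProb_mul_sq_le_lyapunov (hd : 2 ≤ d)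
    (h_lev : IsCorrector (fun C _ => levelDefect γ C) lev β)
    (h_trans : IsCorrector (fun C x => (shift C x : ℝ)) trans β) (hγ : 0 ≤ γ)
    (hφ : IsChart G φ lo hi) {l : ℤ} {L : ℝ} (hL : 0 ≤ L) (hM : L + β + d + 4 ≤ M) {T₀ : ℕ}
    (h_lo : 2 * lo ≤ b - M) (h_hi : l + M + 1 ≤ hi)
    (hb : b + 2 * M + 4 + γ * T₀ ≤ 2 * l + M) {T : ℕ} (hT : T ≤ T₀)
    (h : Realizes φ M b Z C y k) :
    failProb G Z {φ (l, l)} T * L ^ 2 ≤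
      lyapunov lev trans γ β (2 * l + M + L + β) C y k T := by
  induction T using Nat.strong_induction_on generalizing Z C y k with
  | _ T ih =>
  refine h.mul_le_lyapunov_of_ne_allWhite hd h_lev h_trans fun C y k hC h => ?_
  rcases le_or_gt (L ^ 2) (lyapunov lev trans γ β (2 * l + M + L + β) C y k T) with h_ge | h_lt
  · exact (mul_le_of_le_one_left (sq_nonneg L) (failProb_le_one _ _ _)).trans h_ge
  obtain ⟨h_level, h_pos⟩ :=
    abs_lt_of_lyapunov_lt hL (h_lev.abs_apply_le C) (h_trans.abs_apply_le C) h_lt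
  have h_band : |y| ≤ M - d - 4 := by
    have h_real : |(y : ℝ)| ≤ M - d - 4 := by linarith
    exact_mod_cast h_real
  have h_time : γ * T ≤ γ * T₀ := by gcongr
  rw [abs_lt] at h_level
  have h_nonneg : 0 ≤ γ * T₀ := by positivity
  have hbl : b ≤ 2 * l := by
    have h_real : (b : ℝ) ≤ 2 * l := by
      linarith [(abs_nonneg _).trans (h_lev.abs_apply_le C)]
    exact_mod_cast h_real
  rcases le_or_gt (2 * l + M) k with h_reached | h_below
  · have h_mem : φ (l, l) ∈ Z := h.target_mem hC h_reached h_band hbl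
    rw [failProb_eq_zero (by simpa using h_mem), zero_mul]
    exact lyapunov_nonneg
  have h_int : IsInteriorWindow lo hi M b d y k := by
    refine ⟨h_lo, by omega, ?_, h_band⟩
    have h_real : (b + 2 * M + 4 : ℝ) ≤ k := by linarith
    exact_mod_cast h_real
  have h_below' : (k : ℝ) < 2 * l + M := by exact_mod_cast h_below
  cases T with
  | zero => exact absurd h_level.1 (by push_cast; linarith)
  | succ T =>
    have h_mean := h.failProb_succ_mul_le (by omega) hφ hC h_int (r := L ^ 2) (B := {φ (l, l)})
      fun Z' C' y' k' h' => ih T T.lt_succ_self (by omega) h'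
    have h_next := noiseMean_lyapunov_le hd h_lev h_trans (2 * l + M + L + β) C y k T
    rw [timeStep, if_neg hC] at h_next
    exact h_mean.trans h_next

end Window

section DiagonalRun

/-- The points of the square lattice both of whose coordinates have absolute value at most `r`. The
charted squares of this form are the initial blue sets of the diagonal runs. -/
def latticeSquare (r : ℤ) : Set (ℤ × ℤ) := Set.Icc (-r) r ×ˢ Set.Icc (-r) r

lemma latticeSquare_mono {k r : ℤ} (h : k ≤ r) : latticeSquare k ⊆ latticeSquare r :=
  Set.prod_mono (Set.Icc_subset_Icc (neg_le_neg h) h) (Set.Icc_subset_Icc (neg_le_neg h) h)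

variable {V : Type*} {G : SimpleGraph V} {φ : ℤ × ℤ → V} {d M l : ℕ} {γ β : ℝ}
  {lev trans : Config d → ℝ}

lemma lyapunov_allBlue_le (hd : 2 ≤ d) {K : ℝ} {T : ℕ} (h_lev : |lev (allBlue d)| ≤ β)
    (h_trans : |trans (allBlue d)| ≤ β) (hT : |γ * T - K| ≤ 1) :
    lyapunov lev trans γ β K (allBlue d) (d - 1) 0 T ≤
      2 * (d + 1 + β) ^ 2 + 4 * β ^ 2 * T := by
  have hd' : (2 : ℝ) ≤ d := mod_cast hd
  have h_ne : allBlue d ≠ allWhite d := ne_allWhite_iff.2 ⟨⟨0, by omega⟩, rfl⟩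
  rw [abs_le] at h_lev h_trans hT
  have h_level : (γ * T + lev (allBlue d) - K) ^ 2 ≤ (d + 1 + β) ^ 2 :=
    sq_le_sq' (by linarith) (by linarith)
  have h_pos : ((d : ℝ) - 1 + trans (allBlue d)) ^ 2 ≤ (d + 1 + β) ^ 2 :=
    sq_le_sq' (by linarith) (by linarith)
  rw [lyapunov, if_neg h_ne]
  push_cast
  linarith

lemma realizes_allBlue_image (hd : 2 ≤ d) (hM : d ≤ M) :
    Realizes φ M (-(3 * M + 5)) (φ '' latticeSquare (2 * M + 3)) (allBlue d) (d - 1) 0 := by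
  have h_ne : allBlue d ≠ allWhite d := ne_allWhite_iff.2 ⟨⟨0, by omega⟩, rfl⟩
  rw [Realizes, if_neg h_ne]
  refine ⟨0, by ring, fun ⟨s, h_s⟩ _ i j h_i h_j h_ij h_ji h_sum => ?_⟩
  simp only at h_i h_j
  exact Set.mem_image_of_mem φ ⟨⟨by omega, by omega⟩, ⟨by omega, by omega⟩⟩

lemma failProb_diagonal_le [Finite V] (hd : 2 ≤ d)
    (h_lev : IsCorrector (fun C _ => levelDefect γ C) lev β)
    (h_trans : IsCorrector (fun C x => (shift C x : ℝ)) trans β) (hγ : 0 ≤ γ)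
    (hφ : IsChart G φ (-(2 * M + 6)) (l + M + 1)) (hM : 2 * (β + d + 4) ≤ M) {T : ℕ}
    (hT : |γ * T - (2 * l + M + M / 2 + β)| ≤ 1) :
    failProb G (φ '' latticeSquare (2 * M + 3)) {φ (l, l)} T ≤
      (2 * (d + 1 + β) ^ 2 + 4 * β ^ 2 * T) * 4 / M ^ 2 := by
  have hβ : 0 ≤ β := (abs_nonneg _).trans (h_lev.abs_apply_le (allBlue d))
  have hM_pos : (0 : ℝ) < M := by linarith [(Nat.cast_nonneg d : (0 : ℝ) ≤ d)]
  have hdM : d ≤ M := by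
    have : (d : ℝ) ≤ M := by linarith
    exact_mod_cast this
  have h_run := (realizes_allBlue_image hd hdM).failProb_mul_sq_le_lyapunov hd h_lev h_trans hγ hφ
    (l := l) (L := M / 2) (by positivity) (by push_cast; linarith) (by omega) le_rfl
    (T₀ := T) (by push_cast; linarith [(abs_le.1 hT).2]) le_rfl
  have h_start := lyapunov_allBlue_le hd (h_lev.abs_apply_le _) (h_trans.abs_apply_le _) hT
  simp only [Int.cast_natCast] at h_run
  rw [le_div_iff₀ (by positivity)]
  linarith

end DiagonalRun

section Grid

variable {m n : ℕ} {p q : ℤ × ℤ}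

/-- The map of the square lattice that carries the origin to `p` and scales the axes by `σ` and
`τ`. With signs for `σ` and `τ` it gives the charts of the grid, with `σ = τ = l` the coarse lattice
of mesh `l` around `p`. -/
def scaledShift (p : ℤ × ℤ) (σ τ : ℤ) (e : ℤ × ℤ) : ℤ × ℤ := (p.1 + σ * e.1, p.2 + τ * e.2)

lemma injective_scaledShift {σ τ : ℤ} (hσ : σ ≠ 0) (hτ : τ ≠ 0) :
    Function.Injective (scaledShift p σ τ) := by
  rintro ⟨x, y⟩ ⟨x', y'⟩ h
  simpa [scaledShift, hσ, hτ] using h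

lemma scaledShift_mem {σ τ r : ℤ} (hσ : IsUnit σ) (hτ : IsUnit τ)
    (hp : p ∈ Set.Ico r (m - r) ×ˢ Set.Ico r (n - r)) {e : ℤ × ℤ} (he : e ∈ latticeSquare r) :
    scaledShift p σ τ e ∈ Set.Ico 0 (m : ℤ) ×ˢ Set.Ico 0 (n : ℤ) := by
  simp only [latticeSquare, scaledShift, Set.mem_prod, Set.mem_Ico, Set.mem_Icc] at hp he ⊢
  rcases Int.isUnit_iff.1 hσ with rfl | rfl <;> rcases Int.isUnit_iff.1 hτ with rfl | rfl <;> omega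

lemma edist_pathGraph_le (i j : Fin n) :
    (SimpleGraph.pathGraph n).edist i j ≤ (((i : ℕ) - (j : ℕ) : ℤ).natAbs : ℕ∞) := by
  wlog h : i ≤ j generalizing i j
  · rw [SimpleGraph.edist_comm, ← Int.natAbs_neg, neg_sub]
    exact this j i (le_of_not_ge h)
  obtain ⟨k, hk⟩ := Nat.exists_eq_add_of_le (Fin.le_def.1 h)
  induction k generalizing j with
  | zero => simp [Fin.ext hk]
  | succ k ih =>
    let j' : Fin n := ⟨i + k, by omega⟩
    have h_adj : (SimpleGraph.pathGraph n).Adj j' j :=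
      SimpleGraph.pathGraph_adj.2 (Or.inl (by simp only [j']; omega))
    calc (SimpleGraph.pathGraph n).edist i j
        ≤ (SimpleGraph.pathGraph n).edist i j' + (SimpleGraph.pathGraph n).edist j' j :=
          SimpleGraph.edist_triangle
      _ ≤ ((((i : ℕ) - (j' : ℕ) : ℤ).natAbs : ℕ) : ℕ∞) + 1 :=
          add_le_add (ih j' (Fin.le_def.2 (Nat.le_add_right _ _)) rfl)
            (SimpleGraph.edist_eq_one_iff_adj.2 h_adj).le
      _ = (((i : ℕ) - (j : ℕ) : ℤ).natAbs : ℕ∞) := by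
          rw [← Nat.cast_add_one, Nat.cast_inj]
          simp only [j']
          omega

variable [NeZero m] [NeZero n]

lemma connected_grid : (grid m n).Connected := by
  obtain ⟨m, rfl⟩ := Nat.exists_eq_succ_of_ne_zero (NeZero.ne m)
  obtain ⟨n, rfl⟩ := Nat.exists_eq_succ_of_ne_zero (NeZero.ne n)
  exact (SimpleGraph.pathGraph_connected m).boxProd (SimpleGraph.pathGraph_connected n)

/-- The vertex of the grid with integer coordinates `p`. It is meaningful for `p` in
`[0, m) × [0, n)`. -/
def gridPoint (m n : ℕ) [NeZero m] [NeZero n] (p : ℤ × ℤ) : Fin m × Fin n :=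
  (Fin.ofNat m p.1.toNat, Fin.ofNat n p.2.toNat)

lemma val_ofNat_toNat {x : ℤ} (hx : x ∈ Set.Ico 0 (n : ℤ)) :
    ((Fin.ofNat n x.toNat : ℕ) : ℤ) = x := by
  obtain ⟨h_nonneg, h_lt⟩ := hx
  rw [Fin.val_ofNat, Nat.mod_eq_of_lt (by omega), Int.toNat_of_nonneg h_nonneg]

lemma exists_gridPoint_eq (u : Fin m × Fin n) :
    ∃ p ∈ Set.Ico 0 (m : ℤ) ×ˢ Set.Ico 0 (n : ℤ), gridPoint m n p = u :=
  ⟨((u.1 : ℕ), (u.2 : ℕ)), by simp, by ext <;> simp [gridPoint]⟩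

lemma injOn_gridPoint :
    Set.InjOn (gridPoint m n) (Set.Ico 0 (m : ℤ) ×ˢ Set.Ico 0 (n : ℤ)) := by
  intro p hp q hq h
  obtain ⟨h₁, h₂⟩ := Prod.mk.inj h
  refine Prod.ext ?_ ?_
  · rw [← val_ofNat_toNat hp.1, h₁, val_ofNat_toNat hq.1]
  · rw [← val_ofNat_toNat hp.2, h₂, val_ofNat_toNat hq.2]

lemma grid_adj_gridPoint (hp : p ∈ Set.Ico 0 (m : ℤ) ×ˢ Set.Ico 0 (n : ℤ))
    (hq : q ∈ Set.Ico 0 (m : ℤ) ×ˢ Set.Ico 0 (n : ℤ)) :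
    (grid m n).Adj (gridPoint m n p) (gridPoint m n q) ↔
      q ∈ ({(p.1 + 1, p.2), (p.1 - 1, p.2), (p.1, p.2 + 1), (p.1, p.2 - 1)} : Set (ℤ × ℤ)) := by
  have h₁ := val_ofNat_toNat hp.1
  have h₂ := val_ofNat_toNat hp.2
  have h₁' := val_ofNat_toNat hq.1
  have h₂' := val_ofNat_toNat hq.2
  rw [grid, SimpleGraph.boxProd_adj, SimpleGraph.pathGraph_adj, SimpleGraph.pathGraph_adj,
    Fin.ext_iff, Fin.ext_iff]
  simp only [gridPoint, Set.mem_insert_iff, Set.mem_singleton_iff, Prod.ext_iff]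
  omega

lemma neighborSet_grid (hp : p ∈ Set.Ico 0 (m : ℤ) ×ˢ Set.Ico 0 (n : ℤ)) :
    (grid m n).neighborSet (gridPoint m n p) = gridPoint m n ''
      ({(p.1 + 1, p.2), (p.1 - 1, p.2), (p.1, p.2 + 1), (p.1, p.2 - 1)} ∩
        Set.Ico 0 (m : ℤ) ×ˢ Set.Ico 0 (n : ℤ)) := by
  ext u
  obtain ⟨q, hq, rfl⟩ := exists_gridPoint_eq u
  rw [SimpleGraph.mem_neighborSet, grid_adj_gridPoint hp hq,
    injOn_gridPoint.mem_image_iff Set.inter_subset_right hq]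
  exact (and_iff_left hq).symm

lemma ncard_neighborSet_grid_le (u : Fin m × Fin n) : ((grid m n).neighborSet u).ncard ≤ 4 := by
  obtain ⟨p, hp, rfl⟩ := exists_gridPoint_eq u
  rw [neighborSet_grid hp]
  refine (Set.ncard_image_le (Set.toFinite _)).trans
    ((Set.ncard_le_ncard Set.inter_subset_left).trans ?_)
  have h_card := Finset.card_le_four (a := (p.1 + 1, p.2)) (b := (p.1 - 1, p.2))
    (c := (p.1, p.2 + 1)) (d := (p.1, p.2 - 1))
  rw [← Set.ncard_coe_finset] at h_card
  simpa using h_card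

lemma dist_gridPoint_le (hp : p ∈ Set.Ico 0 (m : ℤ) ×ˢ Set.Ico 0 (n : ℤ))
    (hq : q ∈ Set.Ico 0 (m : ℤ) ×ˢ Set.Ico 0 (n : ℤ)) :
    (grid m n).dist (gridPoint m n p) (gridPoint m n q) ≤
      (p.1 - q.1).natAbs + (p.2 - q.2).natAbs := by
  have h_edist : (grid m n).edist (gridPoint m n p) (gridPoint m n q) ≤
      ((p.1 - q.1).natAbs + (p.2 - q.2).natAbs : ℕ) := by
    rw [grid, SimpleGraph.edist_boxProd, Nat.cast_add, ← val_ofNat_toNat hp.1,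
      ← val_ofNat_toNat hp.2, ← val_ofNat_toNat hq.1, ← val_ofNat_toNat hq.2]
    exact add_le_add (edist_pathGraph_le _ _) (edist_pathGraph_le _ _)
  rw [← (connected_grid.preconnected _ _).coe_dist_eq_edist] at h_edist
  exact_mod_cast h_edist

lemma dist_scaledShift_le {σ τ : ℤ} {r k : ℕ} (hσ : IsUnit σ) (hτ : IsUnit τ) (hk : k ≤ r)
    (hp : p ∈ Set.Ico (r : ℤ) (m - r) ×ˢ Set.Ico (r : ℤ) (n - r)) {e : ℤ × ℤ}
    (he : e ∈ latticeSquare k) :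
    (grid m n).dist (gridPoint m n p) (gridPoint m n (scaledShift p σ τ e)) ≤ 2 * k := by
  have h_start : p ∈ Set.Ico 0 (m : ℤ) ×ˢ Set.Ico 0 (n : ℤ) := by
    simp only [Set.mem_prod, Set.mem_Ico] at hp ⊢
    omega
  have h_end := scaledShift_mem hσ hτ hp (latticeSquare_mono (Int.ofNat_le.2 hk) he)
  refine (dist_gridPoint_le h_start h_end).trans ?_
  simp only [latticeSquare, scaledShift, Set.mem_prod, Set.mem_Icc] at he ⊢
  rcases Int.isUnit_iff.1 hσ with rfl | rfl <;> rcases Int.isUnit_iff.1 hτ with rfl | rfl <;> omega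

lemma isChart_grid {σ τ lo hi r : ℤ} (hσ : IsUnit σ) (hτ : IsUnit τ) (h_lo : -r ≤ lo - 1)
    (h_hi : hi + 1 ≤ r) (hp : p ∈ Set.Ico r (m - r) ×ˢ Set.Ico r (n - r)) :
    IsChart (grid m n) (gridPoint m n ∘ scaledShift p σ τ) lo hi where
  injOn := injOn_gridPoint.comp (injective_scaledShift hσ.ne_zero hτ.ne_zero).injOn fun e he =>
    scaledShift_mem hσ hτ hp ⟨⟨h_lo.trans he.1.1, he.1.2.trans h_hi⟩,
      ⟨h_lo.trans he.2.1, he.2.2.trans h_hi⟩⟩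
  neighborSet_eq i h_i j h_j := by
    rw [Set.mem_Icc] at h_i h_j
    have h_nbrs : scaledShift p σ τ '' {(i + 1, j), (i - 1, j), (i, j + 1), (i, j - 1)} =
        {((scaledShift p σ τ (i, j)).1 + 1, (scaledShift p σ τ (i, j)).2),
          ((scaledShift p σ τ (i, j)).1 - 1, (scaledShift p σ τ (i, j)).2),
          ((scaledShift p σ τ (i, j)).1, (scaledShift p σ τ (i, j)).2 + 1),
          ((scaledShift p σ τ (i, j)).1, (scaledShift p σ τ (i, j)).2 - 1)} := by
      simp only [Set.image_insert_eq, Set.image_singleton, scaledShift]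
      rcases Int.isUnit_iff.1 hσ with rfl | rfl <;> rcases Int.isUnit_iff.1 hτ with rfl | rfl <;>
        grind
    have h_sub : scaledShift p σ τ '' {(i + 1, j), (i - 1, j), (i, j + 1), (i, j - 1)} ⊆
        Set.Ico 0 (m : ℤ) ×ˢ Set.Ico 0 (n : ℤ) := by
      rintro _ ⟨e, he, rfl⟩
      refine scaledShift_mem hσ hτ hp ?_
      rcases he with rfl | rfl | rfl | rfl <;> exact ⟨⟨by omega, by omega⟩, ⟨by omega, by omega⟩⟩
    rw [Function.comp_apply, neighborSet_grid (scaledShift_mem hσ hτ hp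
      ⟨⟨by omega, by omega⟩, ⟨by omega, by omega⟩⟩), ← h_nbrs, Set.inter_eq_left.2 h_sub,
      Set.image_comp]

lemma failProb_grid_le_of_dist {Z B : Set (Fin m × Fin n)} {D : ℕ}
    (hB : ∀ w ∈ B, ∃ z ∈ Z, (grid m n).dist z w ≤ D) :
    failProb (grid m n) Z B (20 * D) ≤ (m * n : ℕ) * (1 / 10) ^ D := by
  have h_rate : (4 : ℝ) * (1 - 1 / 4 + 1 / 4 ^ 2) ^ 20 ≤ 1 / 10 := by norm_num
  refine (failProb_le_of_dist (Δ := 4) (by norm_num) ncard_neighborSet_grid_le connected_grid hB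
    (20 * D)).trans ?_
  rw [Nat.card_prod, Nat.card_fin, Nat.card_fin, pow_mul, ← mul_pow]
  push_cast
  gcongr

end Grid

section GridRun

variable {d n l m s R T : ℕ} {ρ : ℝ}

lemma exists_sign_step {N : ℕ} {a : ℤ} (h : |a| ≤ N + 1) (h_even : Even (a + (N + 1))) :
    ∃ σ : ℤ, IsUnit σ ∧ |a - σ| ≤ N ∧ Even (a - σ + N) := by
  rw [abs_le] at h
  rw [Int.even_iff] at h_even
  rcases le_or_gt 0 a with h_sign | h_sign
  · exact ⟨1, isUnit_one, abs_le.2 ⟨by omega, by omega⟩, Int.even_iff.2 (by omega)⟩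
  · exact ⟨-1, isUnit_one.neg, abs_le.2 ⟨by omega, by omega⟩, Int.even_iff.2 (by omega)⟩

lemma coord_mem_Ico (hR : R < 2 * l) (hm : l * (s + 1) ≤ m) (hmn : 2 * m ≤ n) {a : ℤ}
    (ha : |a| < s) : m + l * a ∈ Set.Ico (R : ℤ) (n - R) := by
  have hm' : (l : ℤ) * (s + 1) ≤ m := by exact_mod_cast hm
  rw [abs_lt] at ha
  have h_lower : (l : ℤ) * (-s + 1) ≤ l * a := by gcongr; omega
  have h_upper : (l : ℤ) * a ≤ l * (s - 1) := by gcongr; omega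
  constructor <;> linarith

/-- The coarse lattice of mesh `2 * l` with `(s + 1) ^ 2` points, centred at `(m, m)`. -/
def coarsePoint (m l s : ℕ) (e : Fin (s + 1) × Fin (s + 1)) : ℤ × ℤ :=
  scaledShift (m, m) l l (2 * (e.1 : ℕ) - s, 2 * (e.2 : ℕ) - s)

lemma coarsePoint_mem (hm : l * (s + 1) ≤ m) (hl : 0 < l) (hmn : 2 * m ≤ n)
    (e : Fin (s + 1) × Fin (s + 1)) :
    coarsePoint m l s e ∈ Set.Ico 0 (n : ℤ) ×ˢ Set.Ico 0 (n : ℤ) := by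
  have h_mem : ∀ i : Fin (s + 1), (m : ℤ) + l * (2 * (i : ℕ) - s) ∈ Set.Ico 0 (n : ℤ) := fun i => by
    have hm' : (l : ℤ) * (s + 1) ≤ m := by exact_mod_cast hm
    have h_lower : (l : ℤ) * (-s) ≤ l * (2 * (i : ℕ) - s) := by gcongr; omega
    have h_upper : (l : ℤ) * (2 * (i : ℕ) - s) ≤ l * s := by gcongr; omega
    constructor <;> linarith [hm']
  exact ⟨h_mem e.1, h_mem e.2⟩

lemma exists_abs_sub_mul_le {w r x : ℤ} (hr : 0 ≤ r) (hrw : r ≤ w) (s : ℕ) (h_lower : -r ≤ x)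
    (h_upper : x ≤ s * w + r) : ∃ i : Fin (s + 1), |x - (i : ℕ) * w| ≤ w := by
  induction s with
  | zero => exact ⟨0, abs_le.2 ⟨by simp; omega, by simp at h_upper ⊢; omega⟩⟩
  | succ s ih =>
    rcases le_or_gt x (s * w + r) with h | h
    · obtain ⟨i, hi⟩ := ih h
      exact ⟨i.castSucc, hi⟩
    · refine ⟨Fin.last (s + 1), abs_le.2 ?_⟩
      push_cast [Fin.val_last] at h_upper ⊢
      constructor <;> linarith

lemma exists_coarse_near (hsl : s + 1 ≤ l) (hml : m ≤ (s + 1) * (l + 1)) {x : ℤ}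
    (hx : x ∈ Set.Icc 0 (2 * (m : ℤ))) :
    ∃ i : Fin (s + 1), ((m : ℤ) + l * (2 * (i : ℕ) - s) - x).natAbs ≤ 2 * l := by
  have hml' : (m : ℤ) ≤ (s + 1) * (l + 1) := by exact_mod_cast hml
  obtain ⟨i, hi⟩ := exists_abs_sub_mul_le (w := 2 * l) (r := l + s + 1) (x := x - m + s * l)
    (by omega) (by omega) s (by linarith [hx.1, hml']) (by linarith [hx.2, hml'])
  refine ⟨i, ?_⟩
  rw [Int.abs_eq_natAbs, ← Int.natAbs_neg] at hi
  convert Int.ofNat_le.1 hi using 2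
  ring

variable [NeZero n]

/-- From any vertex of the `n` by `n` grid at distance at least `R` from the boundary, and in each
of the four diagonal directions, the process reaches the vertex that is `l` diagonal steps away
within `T` rounds, up to a probability of failure `ρ`. -/
def DiagonalStep (n : ℕ) [NeZero n] (l R T : ℕ) (ρ : ℝ) : Prop :=
  ∀ p ∈ Set.Ico (R : ℤ) (n - R) ×ˢ Set.Ico (R : ℤ) (n - R), ∀ σ τ : ℤ, IsUnit σ → IsUnit τ →
    failProb (grid n n) {gridPoint n n p} {gridPoint n n (scaledShift p σ τ (l, l))} T ≤ ρ

lemma diagonalStep_of_isCorrector (hd : 2 ≤ d) {γ β : ℝ} {lev trans : Config d → ℝ}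
    (h_lev : IsCorrector (fun C _ => levelDefect γ C) lev β)
    (h_trans : IsCorrector (fun C x => (shift C x : ℝ)) trans β) (hγ : 0 ≤ γ) {M : ℕ}
    (hM : 2 * (β + d + 4) ≤ M) (hMl : M + 5 ≤ l)
    (hT : |γ * T - (2 * l + M + M / 2 + β)| ≤ 1) :
    DiagonalStep n l (l + M + 2) (20 * (4 * M + 6) + T)
      ((n * n : ℕ) * (1 / 10) ^ (4 * M + 6) +
        (2 * (d + 1 + β) ^ 2 + 4 * β ^ 2 * T) * 4 / M ^ 2) := by
  intro p hp σ τ hσ hτ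
  have h_chart : IsChart (grid n n) (gridPoint n n ∘ scaledShift p σ τ) (-(2 * M + 6))
      (l + M + 1) := isChart_grid hσ hτ (by push_cast; omega) (by push_cast; omega) hp
  refine (failProb_add _ (gridPoint n n ∘ scaledShift p σ τ '' latticeSquare (2 * M + 3)) _ _
    _).trans (add_le_add (failProb_grid_le_of_dist ?_)
      (failProb_diagonal_le hd h_lev h_trans hγ h_chart hM hT))
  rintro _ ⟨e, he, rfl⟩
  exact ⟨_, rfl, (dist_scaledShift_le (k := 2 * M + 3) hσ hτ (by omega) hp
    (by exact_mod_cast he)).trans (by omega)⟩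

lemma DiagonalStep.failProb_lattice_le (h : DiagonalStep n l R T ρ) (hR : R < 2 * l)
    (hm : l * (s + 1) ≤ m) (hmn : 2 * m ≤ n) {N : ℕ} (hN : N ≤ s) {a b : ℤ} (ha : |a| ≤ N)
    (ha_even : Even (a + N)) (hb : |b| ≤ N) (hb_even : Even (b + N)) :
    failProb (grid n n) {gridPoint n n (m, m)}
      {gridPoint n n (scaledShift (m, m) l l (a, b))} (N * T) ≤ N * ρ := by
  induction N generalizing a b with
  | zero =>
    obtain rfl : a = 0 := by simpa using ha
    obtain rfl : b = 0 := by simpa using hb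
    simp [failProb_eq_zero, scaledShift]
  | succ N ih =>
    push_cast at ha ha_even hb hb_even
    obtain ⟨σ, hσ, ha', ha_even'⟩ := exists_sign_step ha ha_even
    obtain ⟨τ, hτ, hb', hb_even'⟩ := exists_sign_step hb hb_even
    have h_mem : ∀ c : ℤ, |c| ≤ N → m + l * c ∈ Set.Ico (R : ℤ) (n - R) := fun c hc =>
      coord_mem_Ico hR hm hmn (by omega)
    have h_step := h (scaledShift (m, m) l l (a - σ, b - τ)) ⟨h_mem _ ha', h_mem _ hb'⟩ σ τ hσ hτ
    have h_end : scaledShift (scaledShift (m, m) l l (a - σ, b - τ)) σ τ (l, l) =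
        scaledShift (m, m) l l (a, b) := by
      simp only [scaledShift, Prod.mk.injEq]
      constructor <;> ring
    rw [h_end] at h_step
    rw [Nat.succ_mul, Nat.cast_succ, add_one_mul]
    exact (failProb_add _ _ _ _ _).trans
      (add_le_add (ih (by omega) ha' ha_even' hb' hb_even') h_step)

lemma exists_coarsePoint_dist_le (hm : l * (s + 1) ≤ m) (hmn : 2 * m ≤ n) (hnm : n ≤ 2 * m + 1)
    (hsl : s + 1 ≤ l) (hml : m ≤ (s + 1) * (l + 1)) (u : Fin n × Fin n) :
    ∃ e, (grid n n).dist (gridPoint n n (coarsePoint m l s e)) u ≤ 4 * l := by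
  obtain ⟨q, hq, rfl⟩ := exists_gridPoint_eq u
  obtain ⟨i, hi⟩ := exists_coarse_near hsl hml (x := q.1) ⟨hq.1.1, by have := hq.1.2; omega⟩
  obtain ⟨j, hj⟩ := exists_coarse_near hsl hml (x := q.2) ⟨hq.2.1, by have := hq.2.2; omega⟩
  refine ⟨(i, j), (dist_gridPoint_le (coarsePoint_mem hm (by omega) hmn _) hq).trans ?_⟩
  simp only [coarsePoint, scaledShift]
  omega

lemma DiagonalStep.failProb_univ_le (h : DiagonalStep n l R T ρ) (hR : R < 2 * l)
    (hm : l * (s + 1) ≤ m) (hmn : 2 * m ≤ n) (hnm : n ≤ 2 * m + 1) (hsl : s + 1 ≤ l)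
    (hml : m ≤ (s + 1) * (l + 1)) :
    failProb (grid n n) {gridPoint n n (m, m)} Set.univ (s * T + 20 * (4 * l)) ≤
      (s + 1) ^ 2 * (s * ρ) + (n * n : ℕ) * (1 / 10) ^ (4 * l) := by
  refine (failProb_add _ (⋃ e ∈ Finset.univ, {gridPoint n n (coarsePoint m l s e)}) _ _ _).trans
    (add_le_add ((failProb_biUnion_le _ _ _ _).trans ?_) (failProb_grid_le_of_dist fun u _ => ?_))
  · have h_point : ∀ e ∈ (Finset.univ : Finset (Fin (s + 1) × Fin (s + 1))),
        failProb (grid n n) {gridPoint n n (m, m)} {gridPoint n n (coarsePoint m l s e)} (s * T) ≤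
          s * ρ := fun e _ =>
      h.failProb_lattice_le hR hm hmn le_rfl (abs_le.2 ⟨by omega, by omega⟩) (by simp)
        (abs_le.2 ⟨by omega, by omega⟩) (by simp)
    simpa [sq] using Finset.sum_le_card_nsmul _ _ _ h_point
  · obtain ⟨e, he⟩ := exists_coarsePoint_dist_le hm hmn hnm hsl hml u
    exact ⟨_, by simp, he⟩

end GridRun

section Asymptotics

lemma add_one_pow_three_le_ten_pow (M : ℕ) : ((M : ℝ) + 1) ^ 3 ≤ 10 ^ M := by
  induction M with
  | zero => norm_num
  | succ M ih =>
    rw [pow_succ 10]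
    push_cast
    have hM : (0 : ℝ) ≤ M := M.cast_nonneg
    nlinarith [pow_nonneg hM 2, pow_nonneg hM 3]

lemma mul_one_div_ten_pow_le {n M k : ℕ} {A : ℝ} (hn : n ≤ A * (M + 1)) (hk : M ≤ k) :
    ((n * n : ℕ) : ℝ) * (1 / 10) ^ k ≤ A ^ 2 / (M + 1) := by
  have h_pow : ((1 : ℝ) / 10) ^ k ≤ 1 / (M + 1) ^ 3 := by
    calc ((1 : ℝ) / 10) ^ k ≤ (1 / 10) ^ M := pow_le_pow_of_le_one (by norm_num) (by norm_num) hk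
      _ = 1 / 10 ^ M := by rw [one_div_pow]
      _ ≤ _ := one_div_le_one_div_of_le (by positivity) (add_one_pow_three_le_ten_pow M)
  calc ((n * n : ℕ) : ℝ) * (1 / 10) ^ k ≤ (A * (M + 1)) ^ 2 * (1 / (M + 1) ^ 3) := by
        push_cast
        rw [← sq]
        gcongr
    _ = A ^ 2 / (M + 1) := by field_simp

lemma add_mul_div_sq_le {M T : ℕ} {a b τ : ℝ} (ha : 0 ≤ a) (hb : 0 ≤ b) (hτ : 0 ≤ τ) (hM : 1 ≤ M)
    (hT : T ≤ τ * (M + 1)) : (a + b * T) * 4 / M ^ 2 ≤ 16 * (a + b * τ) / (M + 1) := by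
  have hM' : (1 : ℝ) ≤ M := by exact_mod_cast hM
  have h_sq : ((M : ℝ) + 1) ^ 2 ≤ 4 * M ^ 2 := by nlinarith
  have h_num : a + b * T ≤ (a + b * τ) * (M + 1) := by
    calc a + b * T ≤ a * (M + 1) + b * (τ * (M + 1)) := by
          gcongr
          exact le_mul_of_one_le_right ha (by linarith)
      _ = (a + b * τ) * (M + 1) := by ring
  calc (a + b * T) * 4 / M ^ 2 = (a + b * T) * 16 / (4 * M ^ 2) := by field_simp; norm_num
    _ ≤ (a + b * τ) * (M + 1) * 16 / (M + 1) ^ 2 := by gcongr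
    _ = 16 * (a + b * τ) / (M + 1) := by field_simp

variable {d n s : ℕ} {γ β : ℝ}

/-- Half the mesh of the coarse lattice with `(s + 1) ^ 2` points in the `n` by `n` grid. -/
def halfMesh (s n : ℕ) : ℕ := n / (2 * (s + 1))

/-- The allowance for the random fluctuations of one diagonal run: a small fraction of
`halfMesh s n`, but of the same order, hence far above the typical fluctuations. -/
def tolerance (s n : ℕ) : ℕ := halfMesh s n / (s + 1)

/-- The number of rounds of one diagonal run of `halfMesh s n` steps, for a window whose level
increases by `γ` per round on average. -/
def runRounds (γ β : ℝ) (s n : ℕ) : ℕ :=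
  ⌈(2 * halfMesh s n + tolerance s n + tolerance s n / 2 + β) / γ⌉₊

/-- The number of rounds in which the `n` by `n` grid is covered: `s` diagonal runs, each preceded
by the rounds that produce a blue window, followed by a flooding phase. -/
def coverRounds (γ β : ℝ) (s n : ℕ) : ℕ :=
  s * (20 * (4 * tolerance s n + 6) + runRounds γ β s n) + 20 * (4 * halfMesh s n)

lemma halfMesh_mul_le (s n : ℕ) : halfMesh s n * (2 * (s + 1)) ≤ n := Nat.div_mul_le_self _ _

lemma lt_mul_halfMesh_add_one (s n : ℕ) : n < 2 * (s + 1) * (halfMesh s n + 1) :=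
  Nat.lt_mul_div_succ n (by omega)

lemma tolerance_mul_le (s n : ℕ) : tolerance s n * (s + 1) ≤ halfMesh s n :=
  Nat.div_mul_le_self _ _

lemma halfMesh_lt_mul_tolerance_add_one (s n : ℕ) :
    halfMesh s n < (s + 1) * (tolerance s n + 1) :=
  Nat.lt_mul_div_succ _ (by omega)

lemma le_mul_tolerance_add_one (s n : ℕ) : n ≤ 2 * (s + 1) ^ 2 * (tolerance s n + 1) :=
  calc n ≤ 2 * (s + 1) * (halfMesh s n + 1) := (lt_mul_halfMesh_add_one s n).le
    _ ≤ 2 * (s + 1) * ((s + 1) * (tolerance s n + 1)) :=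
        Nat.mul_le_mul_left _ (halfMesh_lt_mul_tolerance_add_one s n)
    _ = _ := by ring

lemma tendsto_tolerance (s : ℕ) : Tendsto (tolerance s) atTop atTop :=
  (Nat.tendsto_div_const_atTop (by omega)).comp (Nat.tendsto_div_const_atTop (by omega))

lemma runRounds_le (hγ : 0 < γ) (hβ : 0 ≤ β) : (runRounds γ β s n : ℝ) ≤
    (2 * halfMesh s n + tolerance s n + tolerance s n / 2 + β) / γ + 1 :=
  (Nat.ceil_lt_add_one (by positivity)).le

lemma abs_mul_runRounds_sub_le (hγ : 0 < γ) (hγ1 : γ ≤ 1) (hβ : 0 ≤ β) :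
    |γ * runRounds γ β s n -
      (2 * halfMesh s n + tolerance s n + tolerance s n / 2 + β)| ≤ 1 := by
  have h_lower := (div_le_iff₀' hγ).1 (Nat.le_ceil
    ((2 * halfMesh s n + tolerance s n + tolerance s n / 2 + β) / γ))
  have h_upper := mul_le_mul_of_nonneg_left (runRounds_le (s := s) (n := n) hγ hβ) hγ.le
  rw [mul_add, mul_div_cancel₀ _ hγ.ne'] at h_upper
  rw [abs_le]
  constructor <;> unfold runRounds at * <;> linarith

lemma runRounds_le_mul_tolerance (hγ : 0 < γ) (hγ1 : γ ≤ 1) (hβ : 0 ≤ β)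
    (hβ_le : 2 * β ≤ tolerance s n) :
    (runRounds γ β s n : ℝ) ≤ (2 * (s + 1) + 4) / γ * (tolerance s n + 1) := by
  have h_mesh : (halfMesh s n : ℝ) ≤ (s + 1) * (tolerance s n + 1) := by
    exact_mod_cast (halfMesh_lt_mul_tolerance_add_one s n).le
  have h_abs := (abs_le.1 (abs_mul_runRounds_sub_le (s := s) (n := n) hγ hγ1 hβ)).2
  rw [div_mul_eq_mul_div, le_div_iff₀' hγ]
  linarith

lemma exists_eventually_failProb_grid_le {lev trans : Config d → ℝ} (hd : 2 ≤ d)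
    (h_lev : IsCorrector (fun C _ => levelDefect γ C) lev β)
    (h_trans : IsCorrector (fun C x => (shift C x : ℝ)) trans β) (hγ : 0 < γ) (hγ1 : γ ≤ 1)
    (hs : s ≠ 0) :
    ∃ A : ℝ, ∀ᶠ n in atTop, ∃ v, failProb (grid n n) {v} Set.univ (coverRounds γ β s n) ≤
      A / (tolerance s n + 1) := by
  have hβ : 0 ≤ β := (abs_nonneg _).trans (h_lev.abs_apply_le (allBlue d))
  set D : ℝ := 2 * (s + 1) ^ 2
  set a : ℝ := 2 * (d + 1 + β) ^ 2
  set τ : ℝ := (2 * (s + 1) + 4) / γ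
  refine ⟨(s + 1) ^ 2 * (s * (D ^ 2 + 16 * (a + 4 * β ^ 2 * τ))) + D ^ 2, ?_⟩
  filter_upwards [(tendsto_tolerance s).eventually_ge_atTop (s + 10),
    (tendsto_natCast_atTop_atTop.comp (tendsto_tolerance s)).eventually_ge_atTop
      (2 * (β + d + 4)), eventually_ne_atTop 0] with n hM_large hM hn
  have : NeZero n := ⟨hn⟩
  have hMl := tolerance_mul_le s n
  have hM_two : tolerance s n * 2 ≤ tolerance s n * (s + 1) := Nat.mul_le_mul_left _ (by omega)
  have hln := halfMesh_mul_le s n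
  have hnl := lt_mul_halfMesh_add_one s n
  have hnD : (n : ℝ) ≤ D * (tolerance s n + 1) := by
    unfold D
    exact_mod_cast le_mul_tolerance_add_one s n
  have h_step : DiagonalStep n _ _ _ _ := diagonalStep_of_isCorrector hd h_lev h_trans hγ.le hM
    (by omega) (abs_mul_runRounds_sub_le hγ hγ1 hβ)
  have h_run := add_le_add (mul_one_div_ten_pow_le (k := 4 * tolerance s n + 6) hnD (by omega))
    (add_mul_div_sq_le (a := a) (b := 4 * β ^ 2) (by positivity) (by positivity) (by positivity)
      (by omega) (runRounds_le_mul_tolerance (s := s) (n := n) hγ hγ1 hβ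
        (by dsimp at hM; linarith)))
  refine ⟨_, (h_step.failProb_univ_le (m := n / 2) (s := s) (by omega) ?_ (by omega) (by omega)
    (by omega) ?_).trans ?_⟩
  · rw [Nat.le_div_iff_mul_le two_pos]; linarith
  · exact (Nat.div_lt_of_lt_mul (by linarith)).le
  · refine (add_le_add (mul_le_mul_of_nonneg_left (mul_le_mul_of_nonneg_left h_run s.cast_nonneg)
      (by positivity)) (mul_one_div_ten_pow_le hnD (by omega))).trans_eq ?_
    ring

lemma eventually_coverRounds_le (hγ : 0 < γ) (hγ1 : γ ≤ 1) (hβ : 0 ≤ β) {η : ℝ} (hη : 0 < η)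
    (hs : 160 ≤ s * η) :
    ∀ᶠ n in atTop, (coverRounds γ β s n : ℝ) ≤ (1 + η) * γ⁻¹ * n := by
  filter_upwards [tendsto_natCast_atTop_atTop.eventually_ge_atTop (242 * s / η : ℝ),
    (tendsto_natCast_atTop_atTop.comp (tendsto_tolerance s)).eventually_ge_atTop (2 * β)]
    with n hn hM
  dsimp at hM
  rw [div_le_iff₀ hη] at hn
  have hMl : (tolerance s n : ℝ) * (s + 1) ≤ halfMesh s n := by
    exact_mod_cast tolerance_mul_le s n
  have hln : (halfMesh s n : ℝ) * (2 * (s + 1)) ≤ n := by exact_mod_cast halfMesh_mul_le s n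
  have hM0 : (0 : ℝ) ≤ tolerance s n := Nat.cast_nonneg _
  have h_runs : (s : ℝ) * runRounds γ β s n ≤ n * γ⁻¹ + s := by
    calc (s : ℝ) * runRounds γ β s n ≤
        s * ((2 * halfMesh s n + 2 * tolerance s n) / γ + 1) := by
          refine mul_le_mul_of_nonneg_left ((runRounds_le hγ hβ).trans ?_) s.cast_nonneg
          gcongr ?_ / γ + 1
          linarith [hM0]
      _ = s * (2 * halfMesh s n + 2 * tolerance s n) * γ⁻¹ + s := by ring
      _ ≤ n * γ⁻¹ + s := by
          gcongr
          linarith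
  have h_mesh : 160 * (halfMesh s n : ℝ) ≤ η / 2 * n := by
    linarith [mul_le_mul_of_nonneg_right hs (halfMesh s n).cast_nonneg' (α := ℝ),
      mul_le_mul_of_nonneg_left hln hη.le, mul_nonneg hη.le (halfMesh s n).cast_nonneg' (α := ℝ)]
  have h_inv : η * 1 * n ≤ η * γ⁻¹ * n := by
    gcongr
    exact (one_le_inv₀ hγ).2 hγ1
  unfold coverRounds
  push_cast
  linarith

lemma eventually_failProb_grid_le {lev trans : Config d → ℝ} (hd : 2 ≤ d)
    (h_lev : IsCorrector (fun C _ => levelDefect γ C) lev β)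
    (h_trans : IsCorrector (fun C x => (shift C x : ℝ)) trans β) (hγ : 0 < γ) (hγ1 : γ ≤ 1)
    {η δ : ℝ} (hη : 0 < η) (hδ : 0 < δ) :
    ∀ᶠ n : ℕ in atTop, ∃ (v : Fin n × Fin n) (T : ℕ),
      failProb (grid n n) {v} Set.univ T ≤ δ ∧ (T : ℝ) ≤ (1 + η) * γ⁻¹ * n := by
  have hβ : 0 ≤ β := (abs_nonneg _).trans (h_lev.abs_apply_le (allBlue d))
  obtain ⟨s, hs⟩ := exists_nat_ge (160 / η)
  rw [div_le_iff₀ hη] at hs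
  have hs0 : s ≠ 0 := by
    rintro rfl
    norm_num at hs
  obtain ⟨A, hA⟩ := exists_eventually_failProb_grid_le hd h_lev h_trans hγ hγ1 hs0
  have h_tendsto : Tendsto (fun n => A / ((tolerance s n : ℝ) + 1)) atTop (𝓝 0) :=
    (tendsto_atTop_add_const_right _ _
      (tendsto_natCast_atTop_atTop.comp (tendsto_tolerance s))).const_div_atTop A
  filter_upwards [hA, eventually_coverRounds_le hγ hγ1 hβ hη hs, h_tendsto.eventually_le_const hδ]
    with n ⟨v, hv⟩ hT hAδ
  exact ⟨v, _, hv.trans hAδ, hT⟩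

lemma exists_tendsto_atTop_of_eventually {Q : ℕ → ℕ → Prop} (h : ∀ k, ∀ᶠ n in atTop, Q k n) :
    ∃ f : ℕ → ℕ, Tendsto f atTop atTop ∧ ∀ᶠ n in atTop, Q (f n) n := by
  choose N hN using fun k => eventually_atTop.1 (h k)
  refine ⟨fun n => Nat.findGreatest (fun k => N k ≤ n) n, tendsto_atTop.2 fun k => ?_, ?_⟩
  · filter_upwards [eventually_ge_atTop k, eventually_ge_atTop (N k)] with n hkn hNn
    exact Nat.le_findGreatest hkn hNn
  · filter_upwards [eventually_ge_atTop (N 0)] with n hn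
    exact hN _ n (Nat.findGreatest_spec (P := fun k => N k ≤ n) (Nat.zero_le n) hn)

variable {V : Type*}

instance [Fintype V] : IsProbabilityMeasure (expMeasure V) := by
  unfold expMeasure
  infer_instance

lemma exists_propTime_eq_of_blueSet_eq_univ {G : SimpleGraph V} {v : V} {T : ℕ} {ω : ExpSpace V}
    (h : blueSet G {v} (ω v) T = Set.univ) : ∃ t ≤ T, propTime G ω = (t : ℕ∞) := by
  have h_le : propTime G ω ≤ (T : ℕ∞) := (iInf_le _ v).trans (iInf₂_le (α := ℕ∞) T h)
  obtain ⟨t, ht⟩ := ENat.ne_top_iff_exists.1 (ne_top_of_le_ne_top (ENat.natCast_ne_top T) h_le)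
  rw [← ht] at h_le
  exact ⟨t, by exact_mod_cast h_le, ht.symm⟩

lemma le_expMeasure_propTime [Fintype V] {G : SimpleGraph V} {v : V} {T : ℕ} {X : ℝ}
    (hT : (T : ℝ) ≤ X) :
    ENNReal.ofReal (1 - failProb G {v} Set.univ T) ≤
      expMeasure V {ω | ∃ t : ℕ, propTime G ω = (t : ℕ∞) ∧ (t : ℝ) ≤ X} := by
  have hm := measurableSet_not_subset_blueSet (G := G) {v} Set.univ T
  have h_run : ENNReal.ofReal (1 - failProb G {v} Set.univ T) =
      runMeasure V {ω | ¬ Set.univ ⊆ blueSet G {v} ω T}ᶜ := by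
    rw [failProb, ← probReal_compl_eq_one_sub hm, measureReal_def, ENNReal.ofReal_toReal
      (measure_ne_top _ _)]
  rw [h_run, ← (measurePreserving_eval (fun _ : V => runMeasure V) v).measure_preimage
    hm.compl.nullMeasurableSet]
  refine measure_mono fun ω hω => ?_
  obtain ⟨t, htT, ht⟩ := exists_propTime_eq_of_blueSet_eq_univ
    (Set.univ_subset_iff.1 (not_not.1 hω))
  exact ⟨t, ht, le_trans (by exact_mod_cast htT) hT⟩

end Asymptotics

end PZF

end

theorem corollary4p4 (d : ℕ) (hd : 2 ≤ d) :
    ∃ π : PZF.Config d → ℝ,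
      PZF.IsStationary (PZF.windowChain d) π ∧
      PZF.IsLimiting (PZF.windowChain d) π ∧
      π (PZF.allWhite d) < 1 / 2 ∧
      ∃ ε : ℕ → ℝ, Tendsto ε atTop (𝓝 0) ∧
        Tendsto
          (fun n : ℕ => PZF.expMeasure (Fin n × Fin n)
            {ω | ∃ t : ℕ, PZF.propTime (PZF.grid n n) ω = (t : ℕ∞) ∧
              (t : ℝ) ≤ (1 + ε n) *
                ((1 - π (PZF.allWhite d)) / (1 - 2 * π (PZF.allWhite d))) * (n : ℝ)})
          atTop (𝓝 1) := by
  obtain ⟨π, hs, hl⟩ := PZF.exists_isStationary_isLimiting_windowChain hd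
  have hμ := PZF.stationary_allWhite_le hd hs
  obtain ⟨lev, trans, β, h_lev, h_trans⟩ := PZF.exists_correctors hd hs hl
  have hγ : 0 < (1 - 2 * π (PZF.allWhite d)) / (1 - π (PZF.allWhite d)) :=
    div_pos (by linarith) (by linarith)
  have hγ1 : (1 - 2 * π (PZF.allWhite d)) / (1 - π (PZF.allWhite d)) ≤ 1 :=
    (div_le_one (by linarith)).2 (by linarith [hs.1 (PZF.allWhite d)])
  obtain ⟨f, hf, h_fail⟩ := PZF.exists_tendsto_atTop_of_eventually fun k : ℕ =>
    PZF.eventually_failProb_grid_le hd h_lev h_trans hγ hγ1 (k.one_div_pos_of_nat (α := ℝ))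
      (k.one_div_pos_of_nat (α := ℝ))
  have hε : Tendsto (fun n => 1 / ((f n : ℝ) + 1)) atTop (𝓝 0) :=
    tendsto_one_div_add_atTop_nhds_zero_nat.comp hf
  have h_lower : Tendsto (fun n => ENNReal.ofReal (1 - 1 / ((f n : ℝ) + 1))) atTop (𝓝 1) := by
    simpa using ENNReal.tendsto_ofReal (hε.const_sub 1)
  refine ⟨π, hs, hl, by linarith, _, hε, tendsto_of_tendsto_of_tendsto_of_le_of_le' h_lower
    tendsto_const_nhds ?_ (Eventually.of_forall fun n => prob_le_one)⟩
  filter_upwards [h_fail] with n ⟨v, T, hvT, hT⟩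
  rw [inv_div] at hT
  exact (ENNReal.ofReal_le_ofReal (sub_le_sub_left hvT 1)).trans (PZF.le_expMeasure_propTime hT)
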